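/- Digraphs may be infinite and may contain loops and pairs of opposite arcs; $\mathrm{Aut}(\Gamma)$ is the automorphism group of $\Gamma$, $G_v$ is the stabilizer of a vertex $v$ in $G=\mathrm{Aut}(\Gamma)$, and $\Gamma/N$ (for $N\le G$) is the digraph of $N$-orbits, with an arc from $A$ to $B$ when $\Gamma$ has an arc from a vertex of $A$ to a vertex of $B$. Let $\vec{\mathbb Z}$ be the digraph on $\mathbb Z$ with arcs $(i,i+1)$, and let $\mathbb Z$ also denote the digraph on $\mathbb Z$ with arcs $(i,i+1)$ and $(i+1,i)$. A digraph is two-ended if it is connected and has exactly two ends (an end is a class of rays of the underlying undirected graph, two rays being equivalent if there are infinitely many pairwise disjoint paths from one to the other). It is vertex-transitive (respectively arc-transitive) if $G$ is transitive on vertices (respectively arcs), and highly-arc-transitive if for every $k\ge 0$ the group $G$ is transitive on the $k$-arcs, i.e. on the sequences $v_0,\dots,v_k$ in which every $(v_i,v_{i+1})$ is an arc. A transitive group action is quasi-primitive if every normal subgroup acts trivially or transitively; a vertex-transitive digraph is locally quasi-primitive if each $G_v$ acts quasi-primitively both on the set of in-neighbours and on the set of out-neighbours of $v$. Theorem. Let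 $\Gamma$ be a two-ended, vertex-transitive and arc-transitive digraph, and let $G=\mathrm{Aut}(\Gamma)$. There are a normal subgroup $N$ of $G$ with finite orbits and an isomorphism from $\Gamma/N$ to $\vec{\mathbb Z}$ or $\mathbb Z$; for the resulting projection $\varphi:\Gamma\to\Gamma/N\cong\vec{\mathbb Z}$ or $\mathbb Z$ all fibres $\Gamma_i=\varphi^{-1}(i)$ have the same finite number $m$ of elements, and $m$ does not depend on the choices made (the fibre size of $\Gamma$). (a) Suppose that $\Gamma$ is locally quasi-primitive. If $m>2$ and $|G_v|>(m-1)!$ for some vertex $v$, then $\Gamma$ is highly-arc-transitive. In particular, if the vertex stabilizers are infinite, then $\Gamma$ is highly-arc-transitive (for every $m$). (b) Suppose instead that every vertex of $\Gamma$ has exactly $p$ out-neighbours, where $p$ is a prime. If $m>2$ and $|G_v|>(m-1)!$ for some vertex $v$, then $\Gamma$ is highly-arc-transitive. In particular, if the vertex stabilizers are infinite, then $\Gamma$ is highly-arc-transitive (for every $m$). -/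

import Mathlib

namespace Digraph

variable {V : Type*}

/-- The automorphism group of a digraph: the bijections of the vertex set that preserve
and reflect arcs. It acts on the vertices by evaluation. -/
abbrev Aut (Γ : Digraph V) : Type _ := Γ.Adj ≃r Γ.Adj

/-- The stabilizer of a vertex in the automorphism group. -/
abbrev vertexStabilizer (Γ : Digraph V) (v : V) : Subgroup Γ.Aut :=
  MulAction.stabilizer Γ.Aut v

/-! ### Transitivity -/

def VertexTransitive (Γ : Digraph V) : Prop :=
  ∀ u v : V, ∃ g : Γ.Aut, g u = v

def ArcTransitive (Γ : Digraph V) : Prop :=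
  ∀ u v u' v' : V, Γ.Adj u v → Γ.Adj u' v' → ∃ g : Γ.Aut, g u = u' ∧ g v = v'

/-- A `k`-arc is a sequence of vertices `s 0, …, s k` in which each `(s i, s (i + 1))`
is an arc. -/
def IsKArc (Γ : Digraph V) (k : ℕ) (s : Fin (k + 1) → V) : Prop :=
  ∀ i : Fin k, Γ.Adj (s i.castSucc) (s i.succ)

/-- The automorphism group is transitive on the set of `k`-arcs. -/
def KArcTransitive (Γ : Digraph V) (k : ℕ) : Prop :=
  ∀ s t : Fin (k + 1) → V, Γ.IsKArc k s → Γ.IsKArc k t → ∃ g : Γ.Aut, ∀ i, g (s i) = t i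

def HighlyArcTransitive (Γ : Digraph V) : Prop :=
  ∀ k : ℕ, Γ.KArcTransitive k

/-! ### Local quasi-primitivity -/

/-- The set of out-neighbours of `v`, with the action of the stabilizer of `v`. -/
def outNeighbours (Γ : Digraph V) (v : V) : SubMulAction (Γ.vertexStabilizer v) V where
  carrier := {w | Γ.Adj v w}
  smul_mem' := fun g w hw => by
    have h : Γ.Adj (g.1 v) (g.1 w) := g.1.map_rel_iff.2 hw
    have hv : g.1 v = v := g.2
    rw [hv] at h
    exact h

/-- The set of in-neighbours of `v`, with the action of the stabilizer of `v`. -/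
def inNeighbours (Γ : Digraph V) (v : V) : SubMulAction (Γ.vertexStabilizer v) V where
  carrier := {w | Γ.Adj w v}
  smul_mem' := fun g w hw => by
    have h : Γ.Adj (g.1 w) (g.1 v) := g.1.map_rel_iff.2 hw
    have hv : g.1 v = v := g.2
    rw [hv] at h
    exact h

/-- A vertex-transitive digraph is locally quasi-primitive if the stabilizer of a vertex acts
quasi-primitively on its in-neighbours and on its out-neighbours (the action is transitive, and
every normal subgroup of the stabilizer acts trivially or transitively). -/
def LocallyQuasiPrimitive (Γ : Digraph V) : Prop :=
  Γ.VertexTransitive ∧ ∀ v : V,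
    MulAction.IsQuasiPreprimitive (Γ.vertexStabilizer v) (Γ.inNeighbours v) ∧
    MulAction.IsQuasiPreprimitive (Γ.vertexStabilizer v) (Γ.outNeighbours v)

/-- Every vertex has exactly `n` out-neighbours. -/
def HasOutValency (Γ : Digraph V) (n : ℕ) : Prop :=
  ∀ v : V, {w | Γ.Adj v w}.encard = n

/-! ### Ends -/

/-- The underlying undirected graph. Loops play no role for paths, rays and connectedness. -/
abbrev underlying (Γ : Digraph V) : SimpleGraph V := Γ.toSimpleGraphInclusive

/-- A ray is a one-way infinite path; the orientation of the arcs is irrelevant. -/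
def IsRay (Γ : Digraph V) (r : ℕ → V) : Prop :=
  Function.Injective r ∧ ∀ n, Γ.underlying.Adj (r n) (r (n + 1))

/-- Two rays belong to the same end if there is an infinite family of pairwise disjoint paths
(possibly of length `0`), each with its initial vertex on the first ray and its terminal vertex
on the second. -/
def SameEnd (Γ : Digraph V) (r r' : ℕ → V) : Prop :=
  ∃ (a b : ℕ → V) (p : ∀ n, Γ.underlying.Walk (a n) (b n)),
    (∀ n, (p n).IsPath ∧ a n ∈ Set.range r ∧ b n ∈ Set.range r') ∧
    ∀ i j, i ≠ j → (p i).support.Disjoint (p j).support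

/-- A digraph is two-ended if it is connected and has exactly two ends. -/
def TwoEnded (Γ : Digraph V) : Prop :=
  Γ.underlying.Connected ∧
  ∃ r₁ r₂ : ℕ → V, Γ.IsRay r₁ ∧ Γ.IsRay r₂ ∧ ¬ Γ.SameEnd r₁ r₂ ∧
    ∀ r, Γ.IsRay r → Γ.SameEnd r r₁ ∨ Γ.SameEnd r r₂

/-! ### Fibres -/

/-- The digraph on `ℤ` with arcs `(i, i + 1)`. -/
def directedLine : Digraph ℤ where
  Adj i j := j = i + 1

/-- The digraph on `ℤ` with arcs `(i, i + 1)` and `(i + 1, i)`. -/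
def undirectedLine : Digraph ℤ where
  Adj i j := j = i + 1 ∨ i = j + 1

/-- The quotient digraph `Γ / N`: its vertices are the `N`-orbits, and `(A, B)` is an arc if and
only if there is an arc of `Γ` from a vertex in `A` to a vertex in `B`. -/
def orbitQuotient (Γ : Digraph V) (N : Subgroup Γ.Aut) :
    Digraph (MulAction.orbitRel.Quotient N V) where
  Adj A B := ∃ v w : V, Γ.Adj v w ∧
    (Quotient.mk (MulAction.orbitRel N V) v) = A ∧ (Quotient.mk (MulAction.orbitRel N V) w) = B

/-- `φ : V → ℤ` is the projection of `Γ` onto a quotient `Γ / N`, identified with the directed or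
the undirected line, where `N` is a normal subgroup of the automorphism group with finite
orbits. -/
def IsLineProjection (Γ : Digraph V) (φ : V → ℤ) : Prop :=
  ∃ N : Subgroup Γ.Aut, N.Normal ∧ (∀ v : V, (MulAction.orbit N v).Finite) ∧
    ((∃ e : (Γ.orbitQuotient N).Adj ≃r directedLine.Adj,
        ∀ v, φ v = e (Quotient.mk (MulAction.orbitRel N V) v)) ∨
     (∃ e : (Γ.orbitQuotient N).Adj ≃r undirectedLine.Adj,
        ∀ v, φ v = e (Quotient.mk (MulAction.orbitRel N V) v)))

/-- All the fibres `φ ⁻¹ {i}` of a projection of `Γ` onto the line have `m` elements. -/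
def IsFibreSize (Γ : Digraph V) (m : ℕ) : Prop :=
  ∃ φ : V → ℤ, Γ.IsLineProjection φ ∧ ∀ i : ℤ, (φ ⁻¹' {i}).encard = m

end Digraph

/-! Everything rests on an integer height with finite fibres that every automorphism preserves up to
sign and translation.

To build it, forget directions. Local finiteness is not assumed but derived: no vertex dominates an
end (`not_dominates`), so a ray representing an end meets each ball finitely often. The translates
of a minimal separator near a given ball then all minimally separate the same two vertices, and only
finitely many sets of a given size do (`finite_minimal_separators`). So balls are finite, and large
ones separate the ends. The signed change of the two sides as such a ball moves (`displacement`) is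
an additive cocycle, nonzero for vertices far apart; its potential is the height. Arc-transitivity
gives all arcs the same length, rescaled to one. Conversely every line projection is such a height
(`IsLineProjection.isHeight`), and two heights are coarsely comparable, so counting long windows
shows that fibre sizes agree.

High arc-transitivity needs quasi-primitivity on out-neighbours, automatic for prime valency. If
arcs go both up and down, the level-preserving part of a vertex stabilizer cannot be transitive on
out-neighbours, so it fixes them; an index argument (`levelFix_image_eq`) turns containment into
equality, the group is trivial and `|G_v| ≤ 2`. If all arcs ascend, consider the pointwise
stabilizer of a fibre. When it is trivial, `G_v` acts faithfully on `m - 1` vertices. Otherwise it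
is transitive on the out-neighbours of each vertex of the fibre, and gluing its elements to the
identity below extends arcs one step at a time. -/

namespace SimpleGraph

variable {V : Type*} {X : SimpleGraph V}

/-! ### Walks avoiding a set of vertices -/

/-- `u` and `v` are joined by a walk that avoids `F`. -/
def JoinedOff (X : SimpleGraph V) (F : Set V) (u v : V) : Prop :=
  ∃ p : X.Walk u v, ∀ x ∈ p.support, x ∉ F

namespace JoinedOff

variable {F F' : Set V} {u v w : V}

theorem refl (h : u ∉ F) : X.JoinedOff F u u :=
  ⟨Walk.nil, by simpa using h⟩

theorem symm (h : X.JoinedOff F u v) : X.JoinedOff F v u := by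
  obtain ⟨p, hp⟩ := h
  exact ⟨p.reverse, by simpa using hp⟩

theorem trans (h : X.JoinedOff F u v) (h' : X.JoinedOff F v w) : X.JoinedOff F u w := by
  obtain ⟨p, hp⟩ := h
  obtain ⟨q, hq⟩ := h'
  refine ⟨p.append q, fun x hx => ?_⟩
  rcases (Walk.mem_support_append_iff p q).1 hx with hx | hx
  exacts [hp x hx, hq x hx]

theorem mono (hF : F' ⊆ F) (h : X.JoinedOff F u v) : X.JoinedOff F' u v := by
  obtain ⟨p, hp⟩ := h
  exact ⟨p, fun x hx hx' => hp x hx (hF hx')⟩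

theorem left_notMem (h : X.JoinedOff F u v) : u ∉ F := by
  obtain ⟨p, hp⟩ := h
  exact hp _ p.start_mem_support

theorem of_adj (h : X.Adj u v) (hu : u ∉ F) (hv : v ∉ F) : X.JoinedOff F u v :=
  ⟨Walk.cons h Walk.nil, by simp [hu, hv]⟩

theorem of_mem_support (p : X.Walk u v) (hp : ∀ x ∈ p.support, x ∉ F) {x : V}
    (hx : x ∈ p.support) : X.JoinedOff F u x := by
  classical
  exact ⟨p.takeUntil x hx, fun y hy => hp y (p.support_takeUntil_subset_support hx hy)⟩

theorem map (g : X ≃g X) (h : X.JoinedOff F u v) : X.JoinedOff (g '' F) (g u) (g v) := by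
  obtain ⟨p, hp⟩ := h
  refine ⟨p.map g.toHom, fun x hx => ?_⟩
  rw [Walk.support_map, List.mem_map] at hx
  obtain ⟨y, hy, rfl⟩ := hx
  rintro ⟨z, hz, hzy⟩
  exact hp y hy (g.injective hzy ▸ hz)

end JoinedOff

/-- A walk that leaves `F` has a last vertex in `F`. -/
theorem Walk.exists_last_mem {F : Set V} {u v : V} (p : X.Walk u v) (hv : v ∉ F)
    (h : ∃ x ∈ p.support, x ∈ F) : ∃ y ∈ F, ∃ z, X.Adj y z ∧ X.JoinedOff F z v := by
  induction p with
  | nil =>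
    obtain ⟨x, hx, hxF⟩ := h
    simp only [Walk.support_nil, List.mem_singleton] at hx
    exact absurd (hx ▸ hxF) hv
  | @cons a b c hab q ih =>
    obtain ⟨x, hx, hxF⟩ := h
    by_cases hq : ∃ x ∈ q.support, x ∈ F
    · exact ih hv hq
    · push Not at hq
      rw [Walk.support_cons, List.mem_cons] at hx
      rcases hx with rfl | hx
      · exact ⟨x, hxF, b, hab, q, hq⟩
      · exact absurd hxF (hq x hx)

/-! ### Balls -/

/-- The ball of radius `D` about `v` in the path metric. -/
def distBall (X : SimpleGraph V) (D : ℕ) (v : V) : Set V := {y | X.dist v y ≤ D}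

theorem mem_distBall_self (D : ℕ) (v : V) : v ∈ X.distBall D v := by
  simp [distBall]

theorem joinedOff_of_mem_distBall (hX : X.Connected) {D : ℕ} {v y : V} {F : Set V}
    (hy : y ∈ X.distBall D v) (hF : Disjoint (X.distBall D v) F) : X.JoinedOff F v y := by
  classical
  obtain ⟨p, hp⟩ := hX.exists_walk_length_eq_dist v y
  refine ⟨p, fun x hx hxF => Set.disjoint_left.1 hF ?_ hxF⟩
  have h1 := dist_le (p.takeUntil x hx)
  have h2 := p.length_takeUntil_le_length hx
  have h3 : X.dist v y ≤ D := hy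
  change X.dist v x ≤ D
  omega

theorem Iso.dist_eq (g : X ≃g X) (hX : X.Connected) (u v : V) :
    X.dist (g u) (g v) = X.dist u v := by
  have key : ∀ (g : X ≃g X) (u v : V), X.dist (g u) (g v) ≤ X.dist u v := by
    intro g u v
    obtain ⟨p, hp⟩ := hX.exists_walk_length_eq_dist u v
    rw [← hp, ← Walk.length_map g.toHom p]
    exact dist_le _
  refine le_antisymm (key g u v) ?_
  simpa using key g.symm (g u) (g v)

theorem Iso.image_distBall (g : X ≃g X) (hX : X.Connected) (D : ℕ) (v : V) :
    g '' X.distBall D v = X.distBall D (g v) := by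
  ext y
  constructor
  · rintro ⟨x, hx, rfl⟩
    change X.dist _ _ ≤ D
    rw [Iso.dist_eq g hX]
    exact hx
  · intro hy
    refine ⟨g.symm y, ?_, by simp⟩
    change X.dist _ _ ≤ D
    rw [← Iso.dist_eq g hX, RelIso.apply_symm_apply]
    exact hy

/-! ### Rays and ends -/

/-- A one-way infinite path. -/
def IsRayMap (X : SimpleGraph V) (r : ℕ → V) : Prop :=
  Function.Injective r ∧ ∀ n, X.Adj (r n) (r (n + 1))

/-- `x` is joined to a tail of `r` off `F`. -/
def EndOff (X : SimpleGraph V) (F : Set V) (r : ℕ → V) (x : V) : Prop :=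
  ∀ᶠ n in Filter.atTop, X.JoinedOff F x (r n)

/-- No finite set of vertices separates `r` from `r'`. -/
def EndEq (X : SimpleGraph V) (r r' : ℕ → V) : Prop :=
  ∀ F : Set V, F.Finite → ∃ x, X.EndOff F r x ∧ X.EndOff F r' x

section Ends

variable {F F' : Set V} {r r' r'' : ℕ → V} {x y : V}

theorem EndOff.notMem (h : X.EndOff F r x) : x ∉ F := by
  obtain ⟨n, hn⟩ := h.exists
  exact hn.left_notMem

theorem EndOff.mono (hF : F' ⊆ F) (h : X.EndOff F r x) : X.EndOff F' r x :=
  Filter.Eventually.mono h fun _ hn => hn.mono hF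

theorem EndOff.of_joinedOff (hxy : X.JoinedOff F x y) (h : X.EndOff F r y) : X.EndOff F r x :=
  Filter.Eventually.mono h fun _ hn => hxy.trans hn

theorem EndOff.joinedOff (h : X.EndOff F r x) (h' : X.EndOff F r y) : X.JoinedOff F x y := by
  obtain ⟨n, hn, hn'⟩ := (h.and h').exists
  exact hn.trans hn'.symm

theorem EndOff.map (g : X ≃g X) (h : X.EndOff F r x) : X.EndOff (g '' F) (g ∘ r) (g x) :=
  Filter.Eventually.mono h fun _ hn => hn.map g

theorem endOff_map_iff (g : X ≃g X) : X.EndOff (g '' F) (g ∘ r) (g x) ↔ X.EndOff F r x := by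
  refine ⟨fun h => ?_, fun h => h.map g⟩
  have := h.map g.symm
  rw [← Set.image_comp, ← Function.comp_assoc] at this
  have e : (g.symm ∘ g : V → V) = id := by ext; simp
  simpa [e] using this

theorem IsRayMap.map (hr : X.IsRayMap r) (g : X ≃g X) : X.IsRayMap (g ∘ r) :=
  ⟨g.injective.comp hr.1, fun n => g.map_adj_iff.2 (hr.2 n)⟩

theorem IsRayMap.eventually_notMem (hr : X.IsRayMap r) (hF : F.Finite) :
    ∃ n₀, ∀ n ≥ n₀, r n ∉ F := by
  have h := hr.1.tendsto_cofinite.eventually hF.eventually_cofinite_notMem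
  rw [Nat.cofinite_eq_atTop] at h
  exact Filter.eventually_atTop.1 h

theorem IsRayMap.joinedOff (hr : X.IsRayMap r) {n₀ : ℕ} (h : ∀ n ≥ n₀, r n ∉ F) {n : ℕ}
    (hn : n₀ ≤ n) : X.JoinedOff F (r n₀) (r n) := by
  induction n, hn using Nat.le_induction with
  | base => exact JoinedOff.refl (h _ le_rfl)
  | succ n hn ih =>
    exact ih.trans (JoinedOff.of_adj (hr.2 n) (h n hn) (h _ (by omega)))

theorem IsRayMap.endOff (hr : X.IsRayMap r) {n₀ : ℕ} (h : ∀ n ≥ n₀, r n ∉ F) {n : ℕ}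
    (hn : n₀ ≤ n) : X.EndOff F r (r n) := by
  filter_upwards [Filter.eventually_ge_atTop n₀] with k hk
  exact (hr.joinedOff h hn).symm.trans (hr.joinedOff h hk)

theorem EndEq.symm (h : X.EndEq r r') : X.EndEq r' r := fun F hF => by
  obtain ⟨x, h1, h2⟩ := h F hF
  exact ⟨x, h2, h1⟩

theorem EndEq.endOff (h : X.EndEq r r') (hF : F.Finite) (hx : X.EndOff F r x) :
    X.EndOff F r' x := by
  obtain ⟨y, h1, h2⟩ := h F hF
  exact h2.of_joinedOff (hx.joinedOff h1)

theorem EndEq.endOff_iff (h : X.EndEq r r') (hF : F.Finite) :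
    X.EndOff F r x ↔ X.EndOff F r' x :=
  ⟨h.endOff hF, h.symm.endOff hF⟩

theorem EndEq.trans (h : X.EndEq r r') (h' : X.EndEq r' r'') : X.EndEq r r'' := fun F hF => by
  obtain ⟨x, h1, h2⟩ := h F hF
  exact ⟨x, h1, h'.endOff hF h2⟩

theorem EndEq.map (g : X ≃g X) (h : X.EndEq r r') : X.EndEq (g ∘ r) (g ∘ r') := fun F hF => by
  obtain ⟨x, h1, h2⟩ := h (g.symm '' F) (hF.image _)
  have e : g '' (g.symm '' F) = F := by
    rw [← Set.image_comp]
    simp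
  exact ⟨g x, e ▸ h1.map g, e ▸ h2.map g⟩

theorem endEq_map_iff (g : X ≃g X) : X.EndEq (g ∘ r) (g ∘ r') ↔ X.EndEq r r' := by
  refine ⟨fun h => ?_, fun h => h.map g⟩
  have := h.map g.symm
  simp only [← Function.comp_assoc] at this
  have e : (g.symm ∘ g : V → V) = id := by ext; simp
  simpa [e] using this

/-- Infinitely many disjoint walks between two rays rule out a finite separator. -/
theorem EndEq.of_disjoint_walks (hr : X.IsRayMap r) (hr' : X.IsRayMap r') {a b : ℕ → V}
    (p : ∀ n, X.Walk (a n) (b n)) (ha : ∀ n, a n ∈ Set.range r) (hb : ∀ n, b n ∈ Set.range r')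
    (hp : ∀ i j, i ≠ j → (p i).support.Disjoint (p j).support) : X.EndEq r r' := by
  intro F hF
  obtain ⟨n₀, h⟩ := hr.eventually_notMem hF
  obtain ⟨n₁, h'⟩ := hr'.eventually_notMem hF
  -- Initial segments of both rays are added to `F`, so that a walk missing the union starts and
  -- ends on tails off `F`. Disjoint walks cannot all meet a finite set.
  have hF' : (F ∪ r '' Set.Iio n₀ ∪ r' '' Set.Iio n₁).Finite :=
    (hF.union ((Set.finite_Iio _).image _)).union ((Set.finite_Iio _).image _)
  set F' := F ∪ r '' Set.Iio n₀ ∪ r' '' Set.Iio n₁ with hF'def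
  obtain ⟨n, hn⟩ : ∃ n, ∀ x ∈ (p n).support, x ∉ F' := by
    by_contra! hcon
    choose f hf hf' using hcon
    have hinj : Function.Injective f := by
      intro i j hij
      by_contra hne
      exact hp i j hne (hf i) (hij ▸ hf j)
    exact Set.infinite_range_of_injective hinj (hF'.subset (Set.range_subset_iff.2 hf'))
  obtain ⟨i, hi⟩ := ha n
  obtain ⟨j, hj⟩ := hb n
  have hi' : n₀ ≤ i := by
    by_contra! hlt
    exact hn _ (p n).start_mem_support (hi ▸ Or.inl (Or.inr ⟨i, hlt, rfl⟩))
  have hj' : n₁ ≤ j := by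
    by_contra! hlt
    exact hn _ (p n).end_mem_support (hj ▸ Or.inr ⟨j, hlt, rfl⟩)
  refine ⟨a n, hi ▸ hr.endOff h hi', ?_⟩
  refine (hj ▸ hr'.endOff h' hj' : X.EndOff F r' (b n)).of_joinedOff ⟨p n, fun x hx hxF => ?_⟩
  exact hn x hx (Or.inl (Or.inl hxF))

/-- Rays that no finite set separates are joined by infinitely many disjoint paths. -/
theorem EndEq.exists_disjoint_paths (h : X.EndEq r r') :
    ∃ (a b : ℕ → V) (p : ∀ n, X.Walk (a n) (b n)),
      (∀ n, (p n).IsPath ∧ a n ∈ Set.range r ∧ b n ∈ Set.range r') ∧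
      ∀ i j, i ≠ j → (p i).support.Disjoint (p j).support := by
  classical
  let Q := Σ a : V, Σ b : V, X.Walk a b
  let R : Q → Q → Prop := fun s t => s.2.2.support.Disjoint t.2.2.support
  have : Std.Symm R := ⟨fun s t hst => List.Disjoint.symm hst⟩
  obtain ⟨f, hf, hf'⟩ := exists_seq_of_forall_finset_exists'
    (fun s : Q => s.2.2.IsPath ∧ s.1 ∈ Set.range r ∧ s.2.1 ∈ Set.range r') R (by
      -- Greedy choice: the vertices of the finitely many paths chosen so far form a finite set, and
      -- the next path avoids it.
      intro s _
      obtain ⟨x, h1, h2⟩ := h (⋃ t ∈ s, {y | y ∈ t.2.2.support})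
        (Set.Finite.biUnion s.finite_toSet fun t _ => List.finite_toSet _)
      obtain ⟨n, hn⟩ := h1.exists
      obtain ⟨m, hm⟩ := h2.exists
      obtain ⟨p, hp⟩ := hn.symm.trans hm
      refine ⟨⟨r n, r' m, p.bypass⟩, ⟨p.bypass_isPath, ⟨n, rfl⟩, ⟨m, rfl⟩⟩, ?_⟩
      intro t ht y hy hy'
      exact hp y (p.support_bypass_subset_support hy') (Set.mem_biUnion ht hy))
  exact ⟨fun n => (f n).1, fun n => (f n).2.1, fun n => (f n).2.2, hf, fun i j hij => hf' hij⟩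

end Ends

/-! ### Separators and domination in vertex-transitive graphs with two ends -/

/-- `F` separates the end of `r` from the end of `r'`. -/
def Separates (X : SimpleGraph V) (F : Set V) (r r' : ℕ → V) : Prop :=
  ∀ x, X.EndOff F r x → ¬ X.EndOff F r' x

/-- No finite set of vertices separates `x` from the end of `r`. -/
def Dominates (X : SimpleGraph V) (r : ℕ → V) (x : V) : Prop :=
  ∀ F : Set V, F.Finite → x ∉ F → X.EndOff F r x

theorem Separates.symm {F : Set V} {r r' : ℕ → V} (h : X.Separates F r r') :
    X.Separates F r' r :=
  fun x h1 h2 => h x h2 h1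

theorem Separates.mono {F F' : Set V} {r r' : ℕ → V} (hF : F ⊆ F') (h : X.Separates F r r') :
    X.Separates F' r r' :=
  fun x h1 h2 => h x (h1.mono hF) (h2.mono hF)

theorem Dominates.congr {r r' : ℕ → V} (h : X.EndEq r r') {x : V} (hx : X.Dominates r x) :
    X.Dominates r' x :=
  fun F hF hxF => h.endOff hF (hx F hF hxF)

theorem Dominates.map {r : ℕ → V} {x : V} (hx : X.Dominates r x) (g : X ≃g X) :
    X.Dominates (g ∘ r) (g x) := by
  intro F hF hxF
  have e : g '' (g.symm '' F) = F := by
    rw [← Set.image_comp]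
    simp
  rw [← e]
  refine (hx _ (hF.image _) ?_).map g
  rintro ⟨y, hy, hyx⟩
  exact hxF (by rw [← hyx]; simpa using hy)

/-- A connected vertex-transitive graph whose two ends contain the rays `r₁` and `r₂`. -/
structure TwoEndedTransitive (X : SimpleGraph V) (r₁ r₂ : ℕ → V) : Prop where
  conn : X.Connected
  trans : ∀ u v : V, ∃ g : X ≃g X, g u = v
  ray₁ : X.IsRayMap r₁
  ray₂ : X.IsRayMap r₂
  ne : ¬ X.EndEq r₁ r₂
  all : ∀ r, X.IsRayMap r → X.EndEq r r₁ ∨ X.EndEq r r₂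

namespace TwoEndedTransitive

variable {r₁ r₂ : ℕ → V}

theorem symm (h : X.TwoEndedTransitive r₁ r₂) : X.TwoEndedTransitive r₂ r₁ :=
  ⟨h.conn, h.trans, h.ray₂, h.ray₁, fun h' => h.ne h'.symm, fun r hr => (h.all r hr).symm⟩

theorem image_ends (h : X.TwoEndedTransitive r₁ r₂) (g : X ≃g X) :
    (X.EndEq (g ∘ r₁) r₁ ∧ X.EndEq (g ∘ r₂) r₂) ∨ (X.EndEq (g ∘ r₁) r₂ ∧ X.EndEq (g ∘ r₂) r₁) := by
  have hne : ¬ X.EndEq (g ∘ r₁) (g ∘ r₂) := fun h' => h.ne ((endEq_map_iff g).1 h')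
  rcases h.all _ (h.ray₁.map g) with h1 | h1 <;> rcases h.all _ (h.ray₂.map g) with h2 | h2
  · exact absurd (h1.trans h2.symm) hne
  · exact Or.inl ⟨h1, h2⟩
  · exact Or.inr ⟨h1, h2⟩
  · exact absurd (h1.trans h2.symm) hne

/-- An automorphism fixes or exchanges the two ends, and separation is symmetric in them. -/
theorem separates_image (h : X.TwoEndedTransitive r₁ r₂) {F : Set V} (hF : F.Finite)
    (hS : X.Separates F r₁ r₂) (g : X ≃g X) : X.Separates (g '' F) r₁ r₂ := by
  intro x h1 h2
  obtain ⟨y, rfl⟩ := g.surjective x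
  have hgF : (g '' F).Finite := hF.image _
  rcases h.image_ends g with ⟨e1, e2⟩ | ⟨e1, e2⟩
  · exact hS y ((endOff_map_iff g).1 ((e1.endOff_iff hgF).2 h1))
      ((endOff_map_iff g).1 ((e2.endOff_iff hgF).2 h2))
  · exact hS y ((endOff_map_iff g).1 ((e1.endOff_iff hgF).2 h2))
      ((endOff_map_iff g).1 ((e2.endOff_iff hgF).2 h1))

theorem separates_image_iff (h : X.TwoEndedTransitive r₁ r₂) {F : Set V} (hF : F.Finite)
    (g : X ≃g X) : X.Separates (g '' F) r₁ r₂ ↔ X.Separates F r₁ r₂ := by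
  refine ⟨fun hS => ?_, fun hS => h.separates_image hF hS g⟩
  have := h.separates_image (hF.image _) hS g.symm
  rw [← Set.image_comp] at this
  simpa using this

theorem exists_minimal_separator (h : X.TwoEndedTransitive r₁ r₂) [DecidableEq V] :
    ∃ S : Finset V, X.Separates S r₁ r₂ ∧ ∀ s ∈ S, ¬ X.Separates (S.erase s) r₁ r₂ := by
  classical
  have hex : ∃ n, ∃ S : Finset V, S.card = n ∧ X.Separates S r₁ r₂ := by
    have := h.ne
    simp only [EndEq, not_forall] at this
    obtain ⟨F, hF, hno⟩ := this
    refine ⟨_, hF.toFinset, rfl, fun x h1 h2 => ?_⟩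
    rw [hF.coe_toFinset] at h1 h2
    exact hno ⟨x, h1, h2⟩
  obtain ⟨S, hS, hsep⟩ := Nat.find_spec hex
  refine ⟨S, hsep, fun s hs hs' => ?_⟩
  exact Nat.find_min hex (hS ▸ Finset.card_erase_lt_of_mem hs) ⟨_, rfl, hs'⟩

theorem exists_finite_separator (h : X.TwoEndedTransitive r₁ r₂) :
    ∃ S : Set V, S.Finite ∧ X.Separates S r₁ r₂ := by
  classical
  obtain ⟨S, hS, -⟩ := h.exists_minimal_separator
  exact ⟨S, S.finite_toSet, hS⟩

theorem infinite (h : X.TwoEndedTransitive r₁ r₂) : Infinite V :=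
  Infinite.of_injective r₁ h.ray₁.1

/-! ### No vertex dominates an end -/

/-- An edge one of whose ends dominates `r₁` while the other dominates `r₂`. -/
def _root_.SimpleGraph.CrossEdge (X : SimpleGraph V) (r₁ r₂ : ℕ → V) (y z : V) : Prop :=
  X.Adj y z ∧ ((X.Dominates r₁ y ∧ X.Dominates r₂ z) ∨ (X.Dominates r₂ y ∧ X.Dominates r₁ z))

theorem crossEdge_map (h : X.TwoEndedTransitive r₁ r₂) (g : X ≃g X) {y z : V}
    (hyz : X.CrossEdge r₁ r₂ y z) : X.CrossEdge r₁ r₂ (g y) (g z) := by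
  refine ⟨g.map_adj_iff.2 hyz.1, ?_⟩
  rcases h.image_ends g with ⟨e1, e2⟩ | ⟨e1, e2⟩ <;> rcases hyz.2 with ⟨h1, h2⟩ | ⟨h1, h2⟩
  · exact Or.inl ⟨(h1.map g).congr e1, (h2.map g).congr e2⟩
  · exact Or.inr ⟨(h1.map g).congr e2, (h2.map g).congr e1⟩
  · exact Or.inr ⟨(h1.map g).congr e1, (h2.map g).congr e2⟩
  · exact Or.inl ⟨(h1.map g).congr e2, (h2.map g).congr e1⟩

/-- Transitivity moves such a vertex outside a finite separator, where it would lie on both sides.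
-/
theorem not_dominates_both (h : X.TwoEndedTransitive r₁ r₂) (x : V) :
    ¬ (X.Dominates r₁ x ∧ X.Dominates r₂ x) := by
  rintro ⟨h1, h2⟩
  obtain ⟨S, hS, hsep⟩ := h.exists_finite_separator
  have := h.infinite
  obtain ⟨y, hy⟩ := hS.exists_notMem
  obtain ⟨g, rfl⟩ := h.trans x y
  rcases h.image_ends g with ⟨e1, e2⟩ | ⟨e1, e2⟩
  · exact hsep _ ((h1.map g).congr e1 S hS hy) ((h2.map g).congr e2 S hS hy)
  · exact hsep _ ((h2.map g).congr e2 S hS hy) ((h1.map g).congr e1 S hS hy)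

/-- Otherwise every vertex dominates exactly one end, and by connectedness and transitivity every
vertex lies on a `CrossEdge`. From a vertex far out on `r₁` such edges must lead into the finite
separator `S`, so each vertex has finitely many of them. But then the finitely many vertices of `S`
would have to meet crossing edges from infinitely many vertices of `r₁`. -/
theorem not_dominates (h : X.TwoEndedTransitive r₁ r₂) (x : V) : ¬ X.Dominates r₁ x := by
  intro hx
  obtain ⟨S, hS, hsep⟩ := h.exists_finite_separator
  have hall : ∀ y, X.Dominates r₁ y ∨ X.Dominates r₂ y := by
    intro y
    obtain ⟨g, rfl⟩ := h.trans x y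
    rcases h.image_ends g with ⟨e1, -⟩ | ⟨e1, -⟩
    exacts [Or.inl ((hx.map g).congr e1), Or.inr ((hx.map g).congr e1)]
  obtain ⟨n₁, hn₁⟩ := h.ray₁.eventually_notMem hS
  obtain ⟨n₂, hn₂⟩ := h.ray₂.eventually_notMem hS
  have hd₁ : ∀ n ≥ n₁, X.Dominates r₁ (r₁ n) := fun n hn =>
    (hall _).resolve_right fun hd => hsep _ (h.ray₁.endOff hn₁ hn) (hd S hS (hn₁ n hn))
  have hd₂ : X.Dominates r₂ (r₂ n₂) :=
    (hall _).resolve_left fun hd =>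
      hsep _ (hd S hS (hn₂ n₂ le_rfl)) (h.ray₂.endOff hn₂ le_rfl)
  have hedge : ∃ y z, X.CrossEdge r₁ r₂ y z := by
    obtain ⟨p⟩ := h.conn.preconnected (r₁ n₁) (r₂ n₂)
    obtain ⟨d, -, h1, h2⟩ := p.exists_boundary_dart {y | X.Dominates r₁ y} (hd₁ _ le_rfl)
      (fun h1 => h.not_dominates_both _ ⟨h1, hd₂⟩)
    exact ⟨d.fst, d.snd, d.adj, Or.inl ⟨h1, (hall _).resolve_left h2⟩⟩
  have hcross : ∀ y, ∃ z, X.CrossEdge r₁ r₂ y z := by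
    obtain ⟨y, z, hyz⟩ := hedge
    intro y'
    obtain ⟨g, rfl⟩ := h.trans y y'
    exact ⟨g z, h.crossEdge_map g hyz⟩
  have hcover : ∀ n ≥ n₁, ∀ z, X.CrossEdge r₁ r₂ (r₁ n) z → z ∈ S := by
    intro n hn z hz
    by_contra hzS
    have h2 : X.Dominates r₂ z := by
      rcases hz.2 with ⟨-, h2⟩ | ⟨h1, -⟩
      exacts [h2, absurd ⟨hd₁ n hn, h1⟩ (h.not_dominates_both _)]
    exact hsep _ (h.ray₁.endOff hn₁ hn)
      ((h2 S hS hzS).of_joinedOff (JoinedOff.of_adj hz.1 (hn₁ n hn) hzS))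
  have hfin : ∀ y, {z | X.CrossEdge r₁ r₂ y z}.Finite := by
    intro y
    obtain ⟨g, hg⟩ := h.trans y (r₁ n₁)
    refine Set.Finite.of_finite_image (f := g) (hS.subset ?_) g.injective.injOn
    rintro _ ⟨z, hz, rfl⟩
    exact hcover n₁ le_rfl _ (hg ▸ h.crossEdge_map g hz)
  have hsub : r₁ '' Set.Ici n₁ ⊆ ⋃ s ∈ S, {z | X.CrossEdge r₁ r₂ s z} := by
    rintro _ ⟨n, hn, rfl⟩
    obtain ⟨z, hz⟩ := hcross (r₁ n)
    refine Set.mem_biUnion (hcover n hn z hz) ⟨hz.1.symm, ?_⟩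
    exact hz.2.symm.imp And.symm And.symm
  exact (Set.Ici_infinite n₁).image h.ray₁.1.injOn ((hS.biUnion fun s _ => hfin s).subset hsub)

/-! ### Balls are finite -/

/-- As `x` does not dominate the end, a finite `F` not containing `x` cuts it off from a tail of
`r₁`. A geodesic from `x` to that tail passes through `F`, at positive distance from `x`, so the
radius drops for the induction. -/
theorem finite_dist_le (h : X.TwoEndedTransitive r₁ r₂) (R : ℕ) (x : V) :
    {n | X.dist x (r₁ n) ≤ R}.Finite := by
  classical
  induction R generalizing x with
  | zero =>
    refine Set.Subsingleton.finite fun m hm n hn => h.ray₁.1 ?_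
    simp only [Set.mem_ofPred_eq, nonpos_iff_eq_zero, h.conn.dist_eq_zero_iff] at hm hn
    rw [← hm, ← hn]
  | succ R ih =>
    have := h.not_dominates x
    simp only [Dominates, not_forall] at this
    obtain ⟨F, hF, hxF, hno⟩ := this
    obtain ⟨n₀, hn₀⟩ := h.ray₁.eventually_notMem hF
    refine ((Set.finite_Iio n₀).union (hF.biUnion fun f _ => ih f)).subset fun n hn => ?_
    by_cases hlt : n < n₀
    · exact Or.inl hlt
    right
    push Not at hlt
    obtain ⟨p, hp⟩ := h.conn.exists_walk_length_eq_dist x (r₁ n)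
    have hmeet : ∃ f ∈ p.support, f ∈ F := by
      by_contra! hcon
      exact hno ((h.ray₁.endOff hn₀ hlt).of_joinedOff ⟨p, hcon⟩)
    obtain ⟨f, hf, hfF⟩ := hmeet
    refine Set.mem_biUnion hfF ?_
    have h1 := dist_le (p.dropUntil f hf)
    have h2 : (p.takeUntil f hf).length + (p.dropUntil f hf).length = p.length := by
      rw [← Walk.length_append, Walk.take_spec]
    have h3 : (p.takeUntil f hf).length ≠ 0 := fun h0 =>
      hxF (Walk.eq_of_length_eq_zero h0 ▸ hfF)
    have h4 : X.dist x (r₁ n) ≤ R + 1 := hn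
    change X.dist f (r₁ n) ≤ R
    omega

/-- Two vertices are separated by finitely many minimal sets of `k` vertices. -/
theorem _root_.SimpleGraph.finite_minimal_separators [DecidableEq V] (X : SimpleGraph V) (x y : V)
    (k : ℕ) (F : Finset V) :
    {S : Finset V | S.card = k ∧ ¬ X.JoinedOff ↑(F ∪ S) x y ∧
      ∀ s ∈ S, X.JoinedOff ↑(F ∪ S.erase s) x y}.Finite := by
  induction k generalizing F with
  | zero =>
    refine (Set.finite_singleton ∅).subset fun S hS => ?_
    exact Finset.card_eq_zero.1 hS.1
  | succ k ih =>
    -- Every separator meets a fixed walk `p`. Branch over a common vertex `v`, moving it from `S`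
    -- into `F`. If `F` separates already, a nonempty `S` is not minimal.
    by_cases hF : X.JoinedOff ↑F x y
    · obtain ⟨p, hp⟩ := hF
      refine (Set.Finite.biUnion (List.finite_toSet p.support)
        fun v _ => (ih (insert v F)).image (insert v)).subset fun S hS => ?_
      obtain ⟨hc, hsep, hmin⟩ := hS
      have hmeet : ∃ v ∈ p.support, v ∈ S := by
        by_contra! hcon
        refine hsep ⟨p, fun v hv hv' => ?_⟩
        rcases Finset.mem_union.1 (Finset.mem_coe.1 hv') with h | h
        exacts [hp v hv h, hcon v hv h]
      obtain ⟨v, hv, hvS⟩ := hmeet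
      have e : ∀ T : Finset V, insert v F ∪ T = F ∪ insert v T := by
        intro T; ext; simp only [Finset.mem_union, Finset.mem_insert]; tauto
      refine Set.mem_biUnion hv ⟨S.erase v, ⟨?_, ?_, ?_⟩, Finset.insert_erase hvS⟩
      · rw [Finset.card_erase_of_mem hvS, hc]; rfl
      · rw [e, Finset.insert_erase hvS]; exact hsep
      · intro s hs
        have hne := Finset.ne_of_mem_erase hs
        rw [e, Finset.erase_right_comm, Finset.insert_erase]
        · exact hmin s (Finset.mem_of_mem_erase hs)
        · exact Finset.mem_erase.2 ⟨hne.symm, hvS⟩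
    · convert Set.finite_empty
      ext S
      simp only [Set.mem_ofPred_eq, Set.mem_empty_iff_false, iff_false]
      rintro ⟨hc, -, hmin⟩
      obtain ⟨s, hs⟩ := Finset.card_pos.1 (hc.symm ▸ Nat.succ_pos k : 0 < S.card)
      exact hF ((hmin s hs).mono (by simp))

/-- Each `w` in the ball lies in a translate of a minimal separator `S` of the ends. These
translates all minimally separate one fixed pair of vertices, one on each ray, so there are finitely
many of them. -/
theorem finite_distBall (h : X.TwoEndedTransitive r₁ r₂) (R : ℕ) (x : V) :
    (X.distBall R x).Finite := by
  classical
  obtain ⟨S, hsep, hmin⟩ := h.exists_minimal_separator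
  obtain ⟨D, hD⟩ : ∃ D, ∀ s ∈ S, ∀ t ∈ S, X.dist s t ≤ D := by
    refine ⟨(S ×ˢ S).sup fun a => X.dist a.1 a.2, fun s hs t ht => ?_⟩
    exact Finset.le_sup (f := fun a : V × V => X.dist a.1 a.2) (Finset.mk_mem_product hs ht)
  have hSne : S.Nonempty := by
    rw [Finset.nonempty_iff_ne_empty]
    rintro rfl
    obtain ⟨p⟩ := h.conn.preconnected (r₁ 0) (r₂ 0)
    refine hsep (r₁ 0) (h.ray₁.endOff (n₀ := 0) (by simp) le_rfl) ?_
    exact (h.ray₂.endOff (n₀ := 0) (by simp) le_rfl).of_joinedOff ⟨p, by simp⟩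
  obtain ⟨s₀, hs₀⟩ := hSne
  -- `D` bounds the diameter of `S`, so the translates in question stay within `R + D` of `x`; the
  -- rays are beyond that radius after `n₁` and `n₂`.
  obtain ⟨n₁, hn₁⟩ := (h.finite_dist_le (R + D) x).bddAbove
  obtain ⟨n₂, hn₂⟩ := (h.symm.finite_dist_le (R + D) x).bddAbove
  have hfam := X.finite_minimal_separators (r₁ (n₁ + 1)) (r₂ (n₂ + 1)) S.card ∅
  refine (hfam.biUnion fun T _ => T.finite_toSet).subset fun w hw => ?_
  obtain ⟨g, rfl⟩ := h.trans s₀ w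
  have hwT : g s₀ ∈ S.image g := Finset.mem_image_of_mem _ hs₀
  refine Set.mem_biUnion (x := S.image g) ?_ hwT
  have hdist : ∀ t ∈ S.image g, X.dist x t ≤ R + D := by
    intro t ht
    obtain ⟨s, hs, rfl⟩ := Finset.mem_image.1 ht
    have h1 := h.conn.dist_triangle (u := x) (v := g s₀) (w := g s)
    have h2 := hD s₀ hs₀ s hs
    rw [← Iso.dist_eq g h.conn] at h2
    have h3 : X.dist x (g s₀) ≤ R := hw
    omega
  have ht₁ : ∀ n ≥ n₁ + 1, r₁ n ∉ (S.image g : Finset V) := fun n hn hmem => by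
    have := hn₁ (hdist _ hmem)
    omega
  have ht₂ : ∀ n ≥ n₂ + 1, r₂ n ∉ (S.image g : Finset V) := fun n hn hmem => by
    have := hn₂ (hdist _ hmem)
    omega
  have hsepT : X.Separates ↑(S.image g) r₁ r₂ := by
    rw [Finset.coe_image]
    exact h.separates_image S.finite_toSet hsep g
  refine ⟨Finset.card_image_of_injective _ g.injective, ?_, ?_⟩
  · rw [Finset.empty_union]
    intro hj
    exact hsepT _ (h.ray₁.endOff ht₁ le_rfl) ((h.ray₂.endOff ht₂ le_rfl).of_joinedOff hj)
  · intro t ht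
    obtain ⟨s, hs, rfl⟩ := Finset.mem_image.1 ht
    rw [Finset.empty_union]
    have hno := hmin s hs
    rw [← h.separates_image_iff (Finset.finite_toSet _) g, ← Finset.coe_image,
      Finset.image_erase g.injective] at hno
    simp only [Separates, not_forall, not_not] at hno
    obtain ⟨z, hz₁, hz₂⟩ := hno
    have hsub : ((S.image g).erase (g s) : Finset V) ⊆ S.image g := Finset.erase_subset _ _
    have he₁ := (h.ray₁.endOff ht₁ le_rfl).mono (Finset.coe_subset.2 hsub)
    have he₂ := (h.ray₂.endOff ht₂ le_rfl).mono (Finset.coe_subset.2 hsub)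
    exact (he₁.joinedOff hz₁).trans (hz₂.joinedOff he₂)

theorem exists_distBall_separates (h : X.TwoEndedTransitive r₁ r₂) :
    ∃ D, ∀ v, X.Separates (X.distBall D v) r₁ r₂ := by
  obtain ⟨S, hS, hsep⟩ := h.exists_finite_separator
  obtain ⟨D, hD⟩ : ∃ D, S ⊆ X.distBall D (r₁ 0) := by
    obtain ⟨D, hD⟩ := (hS.image (X.dist (r₁ 0))).bddAbove
    exact ⟨D, fun s hs => hD ⟨s, hs, rfl⟩⟩
  refine ⟨D, fun v => ?_⟩
  obtain ⟨g, rfl⟩ := h.trans (r₁ 0) v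
  rw [← Iso.image_distBall g h.conn]
  exact h.separates_image (h.finite_distBall D _) (hsep.mono hD) g

end TwoEndedTransitive

/-! ### The height as a signed count of vertices changing sides -/

open Classical in
/-- The function with value `1` on the side of `r` of the ball about `v`, value `-1` on the side
of `r'`, and value `0` elsewhere. -/
noncomputable def sideFn (X : SimpleGraph V) (D : ℕ) (r r' : ℕ → V) (v x : V) : ℤ :=
  if X.EndOff (X.distBall D v) r x then 1
  else if X.EndOff (X.distBall D v) r' x then -1 else 0

/-- The signed amount by which the side of `r` shrinks when moving from `v` to `u`. -/
noncomputable def displacement (X : SimpleGraph V) (D : ℕ) (r r' : ℕ → V) (u v : V) : ℤ :=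
  ∑ᶠ x, (X.sideFn D r r' v x - X.sideFn D r r' u x)

namespace TwoEndedTransitive

variable {r₁ r₂ : ℕ → V} {D : ℕ}

theorem sideFn_eq_one {v x : V}
    (hx : X.EndOff (X.distBall D v) r₁ x) : X.sideFn D r₁ r₂ v x = 1 :=
  if_pos hx

theorem sideFn_eq_neg_one (hD : ∀ v, X.Separates (X.distBall D v) r₁ r₂) {v x : V}
    (hx : X.EndOff (X.distBall D v) r₂ x) : X.sideFn D r₁ r₂ v x = -1 := by
  rw [sideFn, if_neg fun h' => hD v x h' hx, if_pos hx]

theorem sideFn_swap (hD : ∀ v, X.Separates (X.distBall D v) r₁ r₂) (v x : V) :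
    X.sideFn D r₂ r₁ v x = -X.sideFn D r₁ r₂ v x := by
  have := hD v x
  unfold sideFn
  split_ifs <;> simp_all

theorem displacement_swap (hD : ∀ v, X.Separates (X.distBall D v) r₁ r₂) (u v : V) :
    X.displacement D r₂ r₁ u v = -X.displacement D r₁ r₂ u v := by
  unfold displacement
  rw [← finsum_neg_distrib]
  refine finsum_congr fun x => ?_
  rw [sideFn_swap hD, sideFn_swap hD]
  ring

theorem sideFn_congr (h : X.TwoEndedTransitive r₁ r₂) {r r' : ℕ → V} (e : X.EndEq r r₁)
    (e' : X.EndEq r' r₂) (v x : V) : X.sideFn D r r' v x = X.sideFn D r₁ r₂ v x := by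
  unfold sideFn
  rw [propext (e.endOff_iff (x := x) (h.finite_distBall D v)),
    propext (e'.endOff_iff (x := x) (h.finite_distBall D v))]

theorem sideFn_map (h : X.TwoEndedTransitive r₁ r₂) (g : X ≃g X) (v x : V) :
    X.sideFn D (g ∘ r₁) (g ∘ r₂) (g v) (g x) = X.sideFn D r₁ r₂ v x := by
  unfold sideFn
  rw [← Iso.image_distBall g h.conn, propext (endOff_map_iff g), propext (endOff_map_iff g)]

/-- Reindex the sum by `g`; if `g` exchanges the ends, `displacement_swap` supplies the sign. -/
theorem displacement_map (h : X.TwoEndedTransitive r₁ r₂)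
    (hD : ∀ v, X.Separates (X.distBall D v) r₁ r₂) (g : X ≃g X) :
    (∀ u v, X.displacement D r₁ r₂ (g u) (g v) = X.displacement D r₁ r₂ u v) ∨
    (∀ u v, X.displacement D r₁ r₂ (g u) (g v) = -X.displacement D r₁ r₂ u v) := by
  have key : ∀ u v, X.displacement D (g ∘ r₁) (g ∘ r₂) (g u) (g v) =
      X.displacement D r₁ r₂ u v := by
    intro u v
    unfold displacement
    rw [← finsum_comp_equiv g.toEquiv]
    exact finsum_congr fun x => congrArg₂ _ (h.sideFn_map g v x) (h.sideFn_map g u x)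
  rcases h.image_ends g with ⟨e1, e2⟩ | ⟨e1, e2⟩
  · left
    intro u v
    rw [← key u v]
    exact finsum_congr fun x => by rw [h.sideFn_congr e1 e2, h.sideFn_congr e1 e2]
  · right
    intro u v
    rw [← key u v, displacement_swap fun v => (hD v).symm]
    exact congrArg Neg.neg
      (finsum_congr fun x => by rw [h.symm.sideFn_congr e1 e2, h.symm.sideFn_congr e1 e2])

/-- All but finitely many vertices are far from a finite set and on the side of an end. -/
theorem finite_setOf_not_endOff (h : X.TwoEndedTransitive r₁ r₂)
    (hD : ∀ v, X.Separates (X.distBall D v) r₁ r₂) {F : Set V} (hF : F.Finite) :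
    {w | ¬ (Disjoint (X.distBall D w) F ∧ (X.EndOff F r₁ w ∨ X.EndOff F r₂ w))}.Finite := by
  obtain ⟨q⟩ := h.conn.preconnected (r₁ 0) (r₂ 0)
  obtain ⟨n₁, hn₁⟩ := h.ray₁.eventually_notMem hF
  obtain ⟨n₂, hn₂⟩ := h.ray₂.eventually_notMem hF
  -- The rays and `q` join the two ends, so the separating ball about `w` meets them. When `w` is
  -- farther than `D` from `E`, it can do so only on a tail of a ray, and the ball, which misses
  -- `F`, joins `w` to that tail.
  have hE : (F ∪ {y | y ∈ q.support} ∪ r₁ '' Set.Iio n₁ ∪ r₂ '' Set.Iio n₂).Finite :=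
    ((hF.union (List.finite_toSet _)).union ((Set.finite_Iio _).image _)).union
      ((Set.finite_Iio _).image _)
  set E := F ∪ {y | y ∈ q.support} ∪ r₁ '' Set.Iio n₁ ∪ r₂ '' Set.Iio n₂ with hEdef
  refine (hE.biUnion fun z _ => h.finite_distBall D z).subset fun w hw => ?_
  by_contra hwE
  have hfar : ∀ z ∈ E, z ∉ X.distBall D w := by
    intro z hz hzw
    refine hwE (Set.mem_biUnion hz ?_)
    change X.dist z w ≤ D
    rw [dist_comm]
    exact hzw
  have hdisj : Disjoint (X.distBall D w) F :=
    Set.disjoint_left.2 fun z hz hzF => hfar z (Or.inl (Or.inl (Or.inl hzF))) hz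
  refine hw ⟨hdisj, ?_⟩
  by_cases h1 : ∃ n, r₁ n ∈ X.distBall D w
  · obtain ⟨n, hn⟩ := h1
    have hle : n₁ ≤ n := by
      by_contra! hlt
      exact hfar _ (Or.inl (Or.inr ⟨n, hlt, rfl⟩)) hn
    exact Or.inl ((h.ray₁.endOff hn₁ hle).of_joinedOff (joinedOff_of_mem_distBall h.conn hn hdisj))
  by_cases h2 : ∃ n, r₂ n ∈ X.distBall D w
  · obtain ⟨n, hn⟩ := h2
    have hle : n₂ ≤ n := by
      by_contra! hlt
      exact hfar _ (Or.inr ⟨n, hlt, rfl⟩) hn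
    exact Or.inr ((h.ray₂.endOff hn₂ hle).of_joinedOff (joinedOff_of_mem_distBall h.conn hn hdisj))
  push Not at h1 h2
  refine (hD w (r₁ 0) (h.ray₁.endOff (n₀ := 0) (fun n _ => h1 n) le_rfl) ?_).elim
  refine (h.ray₂.endOff (n₀ := 0) (fun n _ => h2 n) le_rfl).of_joinedOff ⟨q, fun y hy => ?_⟩
  exact hfar y (Or.inl (Or.inl (Or.inr hy)))

theorem hasFiniteSupport_sideFn_sub (h : X.TwoEndedTransitive r₁ r₂)
    (hD : ∀ v, X.Separates (X.distBall D v) r₁ r₂) (u v : V) :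
    (Function.support fun x => X.sideFn D r₁ r₂ v x - X.sideFn D r₁ r₂ u x).Finite := by
  refine (h.finite_setOf_not_endOff hD
    ((h.finite_distBall D u).union (h.finite_distBall D v))).subset fun x hx => ?_
  rintro ⟨-, hx' | hx'⟩
  · apply hx
    simp only [sideFn_eq_one (hx'.mono Set.subset_union_left),
      sideFn_eq_one (hx'.mono Set.subset_union_right), sub_self]
  · apply hx
    simp only [sideFn_eq_neg_one hD (hx'.mono Set.subset_union_left),
      sideFn_eq_neg_one hD (hx'.mono Set.subset_union_right), sub_self]

theorem displacement_add (h : X.TwoEndedTransitive r₁ r₂)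
    (hD : ∀ v, X.Separates (X.distBall D v) r₁ r₂) (u v w : V) :
    X.displacement D r₁ r₂ u v + X.displacement D r₁ r₂ v w = X.displacement D r₁ r₂ u w := by
  unfold displacement
  rw [← finsum_add_distrib (h.hasFiniteSupport_sideFn_sub hD u v)
    (h.hasFiniteSupport_sideFn_sub hD v w)]
  exact finsum_congr fun x => by ring

/-- The sides nest: the `r₂`-side of `v` lies in that of `u` (`hα`), and the `r₁`-side of `u` in
that of `v` (`hβ`). All terms are thus nonnegative, and the term at `u` is `1`. -/
theorem displacement_pos (h : X.TwoEndedTransitive r₁ r₂)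
    (hD : ∀ v, X.Separates (X.distBall D v) r₁ r₂) {u v : V}
    (hdisj : Disjoint (X.distBall D u) (X.distBall D v))
    (hu : X.EndOff (X.distBall D v) r₁ u) : 0 < X.displacement D r₁ r₂ u v := by
  have h2 : ∀ {x y}, X.EndOff (X.distBall D v) r₂ y → X.JoinedOff (X.distBall D v) x y →
      X.JoinedOff (X.distBall D u) x y := by
    rintro x y hy ⟨p, hp⟩
    refine ⟨p, fun z hz hzu => ?_⟩
    have hzy : X.EndOff (X.distBall D v) r₂ z :=
      hy.of_joinedOff ((JoinedOff.of_mem_support p hp hz).symm.trans ⟨p, hp⟩)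
    exact hD v u hu (hzy.of_joinedOff (joinedOff_of_mem_distBall h.conn hzu hdisj))
  obtain ⟨n₂, hn₂⟩ := h.ray₂.eventually_notMem (h.finite_distBall D v)
  have hα : ∀ x, X.EndOff (X.distBall D v) r₂ x → X.EndOff (X.distBall D u) r₂ x := by
    intro x hx
    filter_upwards [hx, Filter.eventually_ge_atTop n₂] with n hn hle
    exact h2 (h.ray₂.endOff hn₂ hle) hn
  -- Follow a walk from `v` to the tail of `r₂`: just after its last vertex in the ball about `v` it
  -- is on the `r₂`-side.
  have hv : X.EndOff (X.distBall D u) r₂ v := by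
    obtain ⟨p⟩ := h.conn.preconnected v (r₂ n₂)
    obtain ⟨y, hy, z, hyz, hz⟩ := p.exists_last_mem (hn₂ n₂ le_rfl)
      ⟨v, p.start_mem_support, mem_distBall_self D v⟩
    have hzr : X.EndOff (X.distBall D u) r₂ z :=
      hα z ((h.ray₂.endOff hn₂ le_rfl).of_joinedOff hz)
    have hyu : y ∉ X.distBall D u := fun hyu => Set.disjoint_left.1 hdisj hyu hy
    exact hzr.of_joinedOff ((joinedOff_of_mem_distBall h.conn hy hdisj.symm).trans
      (JoinedOff.of_adj hyz hyu hzr.notMem))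
  have hβ : ∀ x, X.EndOff (X.distBall D u) r₁ x → X.EndOff (X.distBall D v) r₁ x := by
    intro x hx
    obtain ⟨n₁, hn₁⟩ := h.ray₁.eventually_notMem (h.finite_distBall D u)
    filter_upwards [hx, Filter.eventually_ge_atTop n₁] with n hn hle
    obtain ⟨p, hp⟩ := hn
    refine ⟨p, fun y hy hyv => ?_⟩
    have hy₁ : X.EndOff (X.distBall D u) r₁ y :=
      (h.ray₁.endOff hn₁ hle).of_joinedOff
        ((JoinedOff.of_mem_support p hp hy).symm.trans ⟨p, hp⟩)
    exact hD u v (hy₁.of_joinedOff (joinedOff_of_mem_distBall h.conn hyv hdisj.symm)) hv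
  have hle : ∀ x, X.sideFn D r₁ r₂ u x ≤ X.sideFn D r₁ r₂ v x := by
    intro x
    have h1 := hα x
    have h2 := hβ x
    unfold sideFn
    split_ifs <;> simp_all
  have hfu : X.sideFn D r₁ r₂ u u = 0 := by
    have : ∀ r, ¬ X.EndOff (X.distBall D u) r u := fun r hr => hr.notMem (mem_distBall_self D u)
    rw [sideFn, if_neg (this _), if_neg (this _)]
  have hfv : X.sideFn D r₁ r₂ v u = 1 := sideFn_eq_one hu
  refine finsum_pos (fun x => sub_nonneg.2 (hle x)) ⟨u, ?_⟩ (h.hasFiniteSupport_sideFn_sub hD u v)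
  rw [hfu, hfv]
  norm_num

/-- A connected vertex-transitive graph with two ends has a function to the integers with finite
fibres that is preserved by all automorphisms up to sign and translation. -/
theorem exists_height (h : X.TwoEndedTransitive r₁ r₂) :
    ∃ φ : V → ℤ, (∀ i, (φ ⁻¹' {i}).Finite) ∧ ∀ g : X ≃g X,
      (∀ u v, φ (g u) - φ (g v) = φ u - φ v) ∨ (∀ u v, φ (g u) - φ (g v) = -(φ u - φ v)) := by
  obtain ⟨D, hD⟩ := h.exists_distBall_separates
  have hsub : ∀ u v, X.displacement D r₁ r₂ u (r₁ 0) - X.displacement D r₁ r₂ v (r₁ 0) =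
      X.displacement D r₁ r₂ u v := fun u v => by
    rw [← h.displacement_add hD u v (r₁ 0)]
    ring
  refine ⟨fun v => X.displacement D r₁ r₂ v (r₁ 0), fun i => ?_, fun g => ?_⟩
  · rcases Set.eq_empty_or_nonempty ((fun v => X.displacement D r₁ r₂ v (r₁ 0)) ⁻¹' {i}) with
      he | ⟨v, hv⟩
    · rw [he]
      exact Set.finite_empty
    -- All but finitely many `u` have balls disjoint from that of `v` and lie on a definite side,
    -- hence have nonzero displacement.
    refine (h.finite_setOf_not_endOff hD (h.finite_distBall D v)).subset fun u hu => ?_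
    have h0 : X.displacement D r₁ r₂ u v = 0 := by
      rw [← hsub]
      simp only [Set.mem_preimage, Set.mem_singleton_iff] at hu hv
      rw [hu, hv, sub_self]
    rintro ⟨hdisj, h1 | h2⟩
    · exact (h.displacement_pos hD hdisj h1).ne' h0
    · have := h.symm.displacement_pos (fun v => (hD v).symm) hdisj h2
      rw [displacement_swap hD, h0] at this
      norm_num at this
  · simp only [hsub]
    exact h.displacement_map hD g

end TwoEndedTransitive

end SimpleGraph

/-! ### From the underlying graph back to digraphs -/

namespace Digraph

variable {V : Type*} {Γ : Digraph V}

theorem Aut.adj_iff (g : Γ.Aut) {u v : V} : Γ.Adj (g u) (g v) ↔ Γ.Adj u v := g.map_rel_iff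

theorem Aut.mul_apply (g k : Γ.Aut) (v : V) : (g * k) v = g (k v) := rfl

theorem Aut.inv_apply_self (g : Γ.Aut) (v : V) : g⁻¹ (g v) = v := g.symm_apply_apply v

theorem Aut.apply_inv_self (g : Γ.Aut) (v : V) : g (g⁻¹ v) = v := g.apply_symm_apply v

theorem underlying_adj {u v : V} :
    Γ.underlying.Adj u v ↔ u ≠ v ∧ (Γ.Adj u v ∨ Γ.Adj v u) :=
  SimpleGraph.fromRel_adj _ _ _

/-- An automorphism of a digraph is an automorphism of the underlying graph. -/
def Aut.toUnderlying (g : Γ.Aut) : Γ.underlying ≃g Γ.underlying where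
  toEquiv := g.toEquiv
  map_rel_iff' := by
    intro u v
    have h : ∀ {a b : V}, Γ.Adj (g.toEquiv a) (g.toEquiv b) ↔ Γ.Adj a b := g.map_rel_iff
    rw [underlying_adj, underlying_adj, h, h, g.toEquiv.injective.ne_iff]

theorem sameEnd_iff {r r' : ℕ → V} (hr : Γ.IsRay r) (hr' : Γ.IsRay r') :
    Γ.SameEnd r r' ↔ Γ.underlying.EndEq r r' := by
  constructor
  · rintro ⟨a, b, p, h, hp⟩
    exact SimpleGraph.EndEq.of_disjoint_walks hr hr' p (fun n => (h n).2.1) (fun n => (h n).2.2) hp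
  · exact fun h => h.exists_disjoint_paths

theorem TwoEnded.exists_twoEndedTransitive (hends : Γ.TwoEnded) (hvert : Γ.VertexTransitive) :
    ∃ r₁ r₂ : ℕ → V, Γ.underlying.TwoEndedTransitive r₁ r₂ := by
  obtain ⟨hconn, r₁, r₂, h1, h2, hne, hall⟩ := hends
  refine ⟨r₁, r₂, hconn, fun u v => ?_, h1, h2, mt (sameEnd_iff h1 h2).2 hne, fun r hr => ?_⟩
  · obtain ⟨g, hg⟩ := hvert u v
    exact ⟨g.toUnderlying, hg⟩
  · exact (hall r hr).imp (sameEnd_iff hr h1).1 (sameEnd_iff hr h2).1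

/-- A property that is preserved along arcs in both directions holds everywhere. -/
theorem connected_induction (hconn : Γ.underlying.Connected) {P : V → Prop} {a : V} (ha : P a)
    (hstep : ∀ u v, Γ.Adj u v → (P u ↔ P v)) (v : V) : P v := by
  obtain ⟨p⟩ := hconn.preconnected a v
  induction p with
  | nil => exact ha
  | cons h q ih =>
    apply ih
    rcases (underlying_adj.1 h).2 with h' | h'
    exacts [(hstep _ _ h').1 ha, (hstep _ _ h').2 ha]

/-! ### Height functions -/

/-- The automorphism `g` multiplies the differences of the values of `φ` by `ε`. -/
def Scales (φ : V → ℤ) (ε : ℤ) (g : Γ.Aut) : Prop :=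
  ∀ u v, φ (g u) - φ (g v) = ε * (φ u - φ v)

theorem Scales.mul {φ : V → ℤ} {ε ε' : ℤ} {g k : Γ.Aut} (hg : Scales φ ε g) (hk : Scales φ ε' k) :
    Scales φ (ε * ε') (g * k) := by
  intro u v
  rw [Aut.mul_apply, Aut.mul_apply, hg, hk]
  ring

theorem Scales.inv {φ : V → ℤ} {ε : ℤ} {g : Γ.Aut} (hg : Scales φ ε g) (hε : ε * ε = 1) :
    Scales φ ε g⁻¹ := by
  intro u v
  have := hg (g⁻¹ u) (g⁻¹ v)
  rw [Aut.apply_inv_self, Aut.apply_inv_self] at this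
  rw [this, ← mul_assoc, hε, one_mul]

/-- A projection to the integers with finite fibres, along which arcs have length one and which is
compatible with all automorphisms. -/
structure IsHeight (Γ : Digraph V) (φ : V → ℤ) : Prop where
  surjective : Function.Surjective φ
  finite_fibre : ∀ i, (φ ⁻¹' {i}).Finite
  adj : ∀ u v, Γ.Adj u v → φ v = φ u + 1 ∨ φ v = φ u - 1
  up : ∀ v, ∃ w, (Γ.Adj v w ∨ Γ.Adj w v) ∧ φ w = φ v + 1
  down : ∀ v, ∃ w, (Γ.Adj v w ∨ Γ.Adj w v) ∧ φ w = φ v - 1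
  scales : ∀ g : Γ.Aut, Scales φ 1 g ∨ Scales φ (-1) g
  trans : ∀ u v, φ u = φ v → ∃ g : Γ.Aut, g u = v ∧ ∀ w, φ (g w) = φ w

/-- All arcs raise the value of `φ` by one. -/
def Ascending (Γ : Digraph V) (φ : V → ℤ) : Prop :=
  ∀ u v, Γ.Adj u v → φ v = φ u + 1

/-- Every vertex has out-neighbours on both sides. -/
def TwoWay (Γ : Digraph V) (φ : V → ℤ) : Prop :=
  ∀ v, (∃ w, Γ.Adj v w ∧ φ w = φ v + 1) ∧ ∃ w, Γ.Adj v w ∧ φ w = φ v - 1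

/-- The automorphisms that preserve all the values of `φ`. -/
def levelGroup (Γ : Digraph V) (φ : V → ℤ) : Subgroup Γ.Aut where
  carrier := {g | ∀ v, φ (g v) = φ v}
  mul_mem' := fun {g k} hg hk v => by rw [Aut.mul_apply, hg, hk]
  one_mem' := fun _ => rfl
  inv_mem' := fun {g} hg v => by rw [← hg (g⁻¹ v), Aut.apply_inv_self]

theorem mem_levelGroup {φ : V → ℤ} {g : Γ.Aut} : g ∈ Γ.levelGroup φ ↔ ∀ v, φ (g v) = φ v :=
  Iff.rfl

/-- If automorphisms act on `φ` by signs and translations, then translations suffice to move every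
vertex to every other one. -/
theorem exists_scales_one (hconn : Γ.underlying.Connected) (hvert : Γ.VertexTransitive)
    (harc : Γ.ArcTransitive) [Infinite V] {φ : V → ℤ} (hfin : ∀ i, (φ ⁻¹' {i}).Finite)
    (hsc : ∀ g : Γ.Aut, Scales φ 1 g ∨ Scales φ (-1) g) {a b : V} (hab : Γ.Adj a b) (u v : V) :
    ∃ g : Γ.Aut, g u = v ∧ Scales φ 1 g := by
  let P : V → V → Prop := fun u v => ∃ g : Γ.Aut, g u = v ∧ Scales φ 1 g
  change P u v
  have hsymm : ∀ {x y}, P x y → P y x := by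
    rintro x _ ⟨g, rfl, hg⟩
    exact ⟨g⁻¹, Aut.inv_apply_self g x, hg.inv (by norm_num)⟩
  have htrans : ∀ {x y z}, P x y → P y z → P x z := by
    rintro x _ _ ⟨g, rfl, hg⟩ ⟨k, rfl, hk⟩
    exact ⟨k * g, rfl, hk.mul hg⟩
  have hneg : ∀ {x y}, ¬ P x y → ∃ g : Γ.Aut, g x = y ∧ Scales φ (-1) g := by
    intro x y hxy
    obtain ⟨g, rfl⟩ := hvert x y
    exact ⟨g, rfl, (hsc g).resolve_left fun hg => hxy ⟨g, rfl, hg⟩⟩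
  -- Two reversals compose to a translation, so `P` has at most two classes; from here on they are
  -- assumed to be distinct.
  have htwo : ∀ {x y z}, ¬ P x y → ¬ P y z → P x z := by
    intro x y z hxy hyz
    obtain ⟨g, rfl, hg⟩ := hneg hxy
    obtain ⟨k, rfl, hk⟩ := hneg hyz
    exact ⟨k * g, rfl, by simpa using hk.mul hg⟩
  by_contra huv
  -- A reversal preserving a class yields one that fixes a vertex, hence by conjugation one fixing
  -- `u`; composed with a reversal from `u` to `v` it gives a translation.
  have hfix : ∀ (n : Γ.Aut) (x : V), Scales φ (-1) n → P x (n x) → False := by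
    rintro n x hn ⟨p, hpx, hp⟩
    obtain ⟨k, rfl⟩ := hvert x u
    obtain ⟨g, rfl, hg⟩ := hneg huv
    have hm : Scales φ (-1) (p⁻¹ * n) := by
      have := (hp.inv (by norm_num)).mul hn
      rwa [one_mul] at this
    have hmx : (p⁻¹ * n) x = x := by
      rw [Aut.mul_apply, ← hpx, Aut.inv_apply_self]
    refine huv ⟨g * (k * (p⁻¹ * n) * k⁻¹), ?_, ?_⟩
    · rw [Aut.mul_apply, Aut.mul_apply, Aut.inv_apply_self, Aut.mul_apply, hmx]
    · rcases hsc k with hk | hk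
      · simpa using hg.mul ((hk.mul hm).mul (hk.inv (by norm_num)))
      · simpa using hg.mul ((hk.mul hm).mul (hk.inv (by norm_num)))
  -- Arcs join different classes: otherwise, by conjugation, no arc leaves its class, contradicting
  -- connectedness.
  have hPab : ¬ P a b := by
    rintro ⟨p, hpa, hp⟩
    have hadj : ∀ x y, Γ.Adj x y → P x y := by
      intro x y hxy
      obtain ⟨g, rfl, rfl⟩ := harc a b x y hab hxy
      refine ⟨g * p * g⁻¹, ?_, ?_⟩
      · rw [Aut.mul_apply, Aut.inv_apply_self, Aut.mul_apply, hpa]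
      · rcases hsc g with hg | hg
        · simpa using (hg.mul hp).mul (hg.inv (by norm_num))
        · simpa using (hg.mul hp).mul (hg.inv (by norm_num))
    refine huv (connected_induction hconn (P := fun x => P u x) ⟨1, rfl, fun x y => ?_⟩
      (fun x y hxy => ⟨fun h => htrans h (hadj x y hxy),
        fun h => htrans h (hsymm (hadj x y hxy))⟩) v)
    rw [one_mul]
    rfl
  have hPadj : ∀ x y, Γ.Adj x y → (P a x ∧ ¬ P a y ∧ φ y - φ x = φ b - φ a) ∨
      (¬ P a x ∧ P a y ∧ φ y - φ x = -(φ b - φ a)) := by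
    intro x y hxy
    obtain ⟨g, rfl, rfl⟩ := harc a b x y hab hxy
    rcases hsc g with hg | hg
    · refine Or.inl ⟨⟨g, rfl, hg⟩, fun h => hPab ?_, by rw [hg, one_mul]⟩
      exact htrans h (hsymm ⟨g, rfl, hg⟩)
    · refine Or.inr ⟨fun h => hfix g a hg h, ?_, by rw [hg]; ring⟩
      exact htwo hPab fun h => hfix g b hg h
  -- Arcs from the class of `a` change `φ` by `φ b - φ a` and arcs back by the opposite amount. So
  -- `φ` has at most two values, contradicting finite fibres.
  have hval := connected_induction hconn
    (P := fun x => (P a x ∧ φ x = φ a) ∨ (¬ P a x ∧ φ x = φ b)) (a := a)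
    (Or.inl ⟨⟨1, rfl, fun x y => by rw [one_mul]; rfl⟩, rfl⟩) (by
      intro x y hxy
      rcases hPadj x y hxy with ⟨h1, h2, h3⟩ | ⟨h1, h2, h3⟩
      · simp only [h1, h2, true_and, not_true, false_and, or_false, not_false_eq_true, false_or]
        constructor <;> intro h <;> linarith
      · simp only [h1, h2, true_and, not_true, false_and, or_false, not_false_eq_true, false_or]
        constructor <;> intro h <;> linarith)
  refine Set.infinite_univ (α := V) (((hfin (φ a)).union (hfin (φ b))).subset fun x _ => ?_)
  rcases hval x with ⟨-, h⟩ | ⟨-, h⟩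
  exacts [Or.inl h, Or.inr h]

theorem surjective_of_up_down [Nonempty V] {φ : V → ℤ} (up : ∀ v, ∃ w, φ w = φ v + 1)
    (down : ∀ v, ∃ w, φ w = φ v - 1) : Function.Surjective φ := by
  obtain ⟨a⟩ := ‹Nonempty V›
  intro i
  induction i using Int.inductionOn' (b := φ a) with
  | zero => exact ⟨a, rfl⟩
  | succ k _ ih =>
    obtain ⟨v, rfl⟩ := ih
    exact up v
  | pred k _ ih =>
    obtain ⟨v, rfl⟩ := ih
    exact down v

/-- All arcs change the height `ψ` by `c` or `-c`, with `c ≠ 0` since `ψ` is not constant; dividing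
by `c` gives `φ`. Translations are transitive on vertices, so every local pattern of arcs recurs at
each vertex with the same orientation. -/
theorem exists_isHeight (hends : Γ.TwoEnded) (hvert : Γ.VertexTransitive)
    (harc : Γ.ArcTransitive) :
    ∃ φ : V → ℤ, Γ.IsHeight φ ∧ (Γ.Ascending φ ∨ Γ.TwoWay φ) := by
  obtain ⟨r₁, r₂, h⟩ := hends.exists_twoEndedTransitive hvert
  have hconn : Γ.underlying.Connected := h.conn
  have := h.infinite
  obtain ⟨ψ, hψ, hψg⟩ := h.exists_height
  obtain ⟨a, b, hab⟩ : ∃ a b, Γ.Adj a b := by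
    rcases (underlying_adj.1 (h.ray₁.2 0)).2 with h' | h'
    exacts [⟨_, _, h'⟩, ⟨_, _, h'⟩]
  have hψs : ∀ g : Γ.Aut, Scales ψ 1 g ∨ Scales ψ (-1) g := by
    intro g
    refine (hψg g.toUnderlying).imp (fun hg u v => ?_) fun hg u v => ?_
    · rw [one_mul]
      exact hg u v
    · rw [neg_one_mul]
      exact hg u v
  set c := ψ b - ψ a with hc
  have hψadj : ∀ u v, Γ.Adj u v → ψ v - ψ u = c ∨ ψ v - ψ u = -c := by
    intro u v huv
    obtain ⟨g, rfl, rfl⟩ := harc a b u v hab huv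
    refine (hψs g).imp (fun hg => ?_) fun hg => ?_
    · rw [hg, one_mul]
    · rw [hg, neg_one_mul]
  have hc0 : c ≠ 0 := by
    intro hc0
    have hconst := connected_induction hconn (P := fun x => ψ x = ψ a) (a := a) rfl (by
      intro u v huv
      have : ψ v = ψ u := by
        rcases hψadj u v huv with h' | h' <;> rw [hc0] at h' <;> linarith
      rw [this])
    exact Set.infinite_univ (α := V) ((hψ (ψ a)).subset fun x _ => hconst x)
  have hdiv : ∀ v, ∃ k : ℤ, ψ v - ψ a = c * k := fun v =>
    connected_induction hconn (P := fun x => c ∣ ψ x - ψ a) (a := a) (by simp) (by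
      intro u v huv
      have hd : c ∣ ψ v - ψ u := by
        rcases hψadj u v huv with h' | h' <;> simp [h']
      rw [show ψ v - ψ a = (ψ u - ψ a) + (ψ v - ψ u) by ring]
      exact (dvd_add_left hd).symm) v
  choose φ hφ using hdiv
  have hdiff : ∀ u v, ψ u - ψ v = c * (φ u - φ v) := by
    intro u v
    rw [mul_sub, ← hφ, ← hφ]
    ring
  have hfin : ∀ i, (φ ⁻¹' {i}).Finite := by
    intro i
    refine (hψ (ψ a + c * i)).subset fun v hv => ?_
    have hv' : φ v = i := hv
    have := hφ v
    rw [hv'] at this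
    change ψ v = _
    linarith
  have hsc : ∀ g : Γ.Aut, Scales φ 1 g ∨ Scales φ (-1) g := by
    intro g
    have hcancel : ∀ {ε : ℤ}, Scales ψ ε g → Scales φ ε g := by
      intro ε hg u v
      have := hg u v
      rw [hdiff, hdiff] at this
      apply mul_left_cancel₀ hc0
      linarith
    exact (hψs g).imp hcancel hcancel
  have hφab : φ b = φ a + 1 := by
    have := hdiff b a
    rw [← hc] at this
    have : φ b - φ a = 1 := by
      apply mul_left_cancel₀ hc0
      linarith
    linarith
  have hadj : ∀ u v, Γ.Adj u v → φ v = φ u + 1 ∨ φ v = φ u - 1 := by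
    intro u v huv
    obtain ⟨g, rfl, rfl⟩ := harc a b u v hab huv
    exact (hsc g).imp (fun hg => by linarith [hg b a]) fun hg => by linarith [hg b a]
  have hone := exists_scales_one hconn hvert harc hfin hsc hab
  have hup : ∀ v, ∃ w, Γ.Adj v w ∧ φ w = φ v + 1 := by
    intro v
    obtain ⟨g, rfl, hg⟩ := hone a v
    exact ⟨g b, g.adj_iff.2 hab, by linarith [hg b a]⟩
  have hdown : ∀ v, ∃ w, Γ.Adj w v ∧ φ w = φ v - 1 := by
    intro v
    obtain ⟨g, rfl, hg⟩ := hone b v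
    exact ⟨g a, g.adj_iff.2 hab, by linarith [hg b a]⟩
  refine ⟨φ, ⟨?_, hfin, hadj, ?_, ?_, hsc, ?_⟩, ?_⟩
  · exact surjective_of_up_down (fun v => (hup v).imp fun _ => And.right)
      fun v => (hdown v).imp fun _ => And.right
  · exact fun v => (hup v).imp fun w hw => ⟨Or.inl hw.1, hw.2⟩
  · exact fun v => (hdown v).imp fun w hw => ⟨Or.inr hw.1, hw.2⟩
  · intro u v huv
    obtain ⟨g, rfl, hg⟩ := hone u v
    exact ⟨g, rfl, fun w => by linarith [hg w u]⟩
  · by_cases hasc : Γ.Ascending φ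
    · exact Or.inl hasc
    right
    simp only [Ascending, not_forall] at hasc
    obtain ⟨x, y, hxy, hne⟩ := hasc
    have hxy' := (hadj x y hxy).resolve_left hne
    refine fun v => ⟨hup v, ?_⟩
    obtain ⟨g, rfl, hg⟩ := hone x v
    exact ⟨g y, g.adj_iff.2 hxy, by linarith [hg y x]⟩

/-! ### Heights and line projections are the same thing -/

variable {φ φ' : V → ℤ}

namespace IsHeight

theorem exists_scales (h : Γ.IsHeight φ) (g : Γ.Aut) :
    ∃ ε : ℤ, (ε = 1 ∨ ε = -1) ∧ Scales φ ε g := by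
  rcases h.scales g with hg | hg
  exacts [⟨1, Or.inl rfl, hg⟩, ⟨-1, Or.inr rfl, hg⟩]

theorem abs_sub_apply (h : Γ.IsHeight φ) (g : Γ.Aut) (u v : V) :
    |φ (g u) - φ (g v)| = |φ u - φ v| := by
  obtain ⟨ε, rfl | rfl, hg⟩ := h.exists_scales g
  · rw [hg, one_mul]
  · rw [hg, neg_one_mul, abs_neg]

theorem apply_eq_apply_iff (h : Γ.IsHeight φ) (g : Γ.Aut) {u v : V} :
    φ (g u) = φ (g v) ↔ φ u = φ v := by
  rw [← sub_eq_zero, ← abs_eq_zero, h.abs_sub_apply, abs_eq_zero, sub_eq_zero]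

theorem levelGroup_normal (h : Γ.IsHeight φ) : (Γ.levelGroup φ).Normal := by
  refine ⟨fun n hn g v => ?_⟩
  have h1 : φ (g (n (g⁻¹ v))) = φ (g (g⁻¹ v)) := (h.apply_eq_apply_iff g).2 (hn _)
  rwa [Aut.apply_inv_self] at h1

theorem mk_eq_mk_iff (h : Γ.IsHeight φ) {u v : V} :
    (Quotient.mk (MulAction.orbitRel (Γ.levelGroup φ) V) u) = Quotient.mk _ v ↔ φ u = φ v := by
  rw [Quotient.eq, MulAction.orbitRel_apply, MulAction.mem_orbit_iff]
  constructor
  · rintro ⟨n, rfl⟩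
    exact n.2 v
  · intro huv
    obtain ⟨g, hg, hg'⟩ := h.trans v u huv.symm
    exact ⟨⟨g, hg'⟩, hg⟩

theorem orbitQuotient_adj_iff (h : Γ.IsHeight φ) {u v : V} :
    (Γ.orbitQuotient (Γ.levelGroup φ)).Adj (Quotient.mk _ u) (Quotient.mk _ v) ↔
      ∃ u' v', Γ.Adj u' v' ∧ φ u' = φ u ∧ φ v' = φ v := by
  simp only [orbitQuotient, h.mk_eq_mk_iff]

/-- The orbits of the level group, identified with the integers. -/
noncomputable def orbitEquiv (h : Γ.IsHeight φ) :
    MulAction.orbitRel.Quotient (Γ.levelGroup φ) V ≃ ℤ :=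
  Equiv.ofBijective (Quotient.lift φ fun _ _ huv => h.mk_eq_mk_iff.1 (Quotient.sound huv)) <| by
    constructor
    · intro A B
      induction A using Quotient.inductionOn
      induction B using Quotient.inductionOn
      exact h.mk_eq_mk_iff.2
    · intro i
      obtain ⟨v, rfl⟩ := h.surjective i
      exact ⟨Quotient.mk _ v, rfl⟩

theorem isLineProjection (h : Γ.IsHeight φ) (hφ : Γ.Ascending φ ∨ Γ.TwoWay φ) :
    Γ.IsLineProjection φ := by
  refine ⟨Γ.levelGroup φ, h.levelGroup_normal, fun v => ?_, hφ.imp (fun hasc => ?_) fun htwo => ?_⟩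
  · refine (h.finite_fibre (φ v)).subset ?_
    rintro _ ⟨n, rfl⟩
    exact n.2 v
  · refine ⟨⟨h.orbitEquiv, ?_⟩, fun v => rfl⟩
    intro A B
    induction A using Quotient.inductionOn with | _ u
    induction B using Quotient.inductionOn with | _ v
    rw [h.orbitQuotient_adj_iff]
    change φ v = φ u + 1 ↔ _
    constructor
    · intro huv
      obtain ⟨w, hw | hw, hw'⟩ := h.up u
      · exact ⟨u, w, hw, rfl, by rw [hw', huv]⟩
      · have := hasc _ _ hw
        omega
    · rintro ⟨u', v', hadj, h1, h2⟩
      rw [← h1, ← h2]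
      exact hasc _ _ hadj
  · refine ⟨⟨h.orbitEquiv, ?_⟩, fun v => rfl⟩
    intro A B
    induction A using Quotient.inductionOn with | _ u
    induction B using Quotient.inductionOn with | _ v
    rw [h.orbitQuotient_adj_iff]
    change (φ v = φ u + 1 ∨ φ u = φ v + 1) ↔ _
    constructor
    · rintro (huv | huv)
      · obtain ⟨⟨w, hw, hw'⟩, -⟩ := htwo u
        exact ⟨u, w, hw, rfl, by omega⟩
      · obtain ⟨-, w, hw, hw'⟩ := htwo u
        exact ⟨u, w, hw, rfl, by omega⟩
    · rintro ⟨u', v', hadj, h1, h2⟩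
      have := h.adj _ _ hadj
      omega

end IsHeight

/-- An injective self-map of the integers that preserves adjacency is affine. -/
theorem eq_add_mul_of_adjacent {σ : ℤ → ℤ} (hinj : Function.Injective σ)
    (hσ : ∀ i, σ (i + 1) = σ i + 1 ∨ σ (i + 1) = σ i - 1) :
    ∃ ε : ℤ, (ε = 1 ∨ ε = -1) ∧ ∀ i, σ i = σ 0 + ε * i := by
  -- Injectivity forbids turning back.
  have hstep : ∀ i, σ (i + 1 + 1) - σ (i + 1) = σ (i + 1) - σ i := by
    intro i
    have hne : σ (i + 1 + 1) ≠ σ i := fun he => by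
      have := hinj he
      omega
    have h1 := hσ i
    have h2 := hσ (i + 1)
    omega
  have hconst : ∀ i, σ (i + 1) - σ i = σ 1 - σ 0 := by
    intro i
    induction i with
    | zero => rw [zero_add]
    | succ k ih => rw [hstep, ih]
    | pred k ih =>
      have := hstep (-(k : ℤ) - 1)
      rw [sub_add_cancel] at this
      rw [sub_add_cancel]
      linarith
  refine ⟨σ 1 - σ 0, ?_, fun i => ?_⟩
  · have := hσ 0
    rw [zero_add] at this
    omega
  · induction i with
    | zero => simp
    | succ k ih => linarith [hconst k]
    | pred k ih =>
      have := hconst (-(k : ℤ) - 1)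
      rw [sub_add_cancel] at this
      linarith

/-- The fibres are the orbits of a normal subgroup, so each automorphism permutes them. The induced
permutation of the integers preserves adjacency, hence is a translation or a reflection. -/
theorem IsLineProjection.isHeight (h : Γ.IsLineProjection φ) :
    Γ.IsHeight φ ∧ (Γ.Ascending φ ∨ Γ.TwoWay φ) := by
  obtain ⟨N, hN, hfin, he⟩ := h
  have hinj : ∀ {u v}, φ u = φ v ↔
      (Quotient.mk (MulAction.orbitRel N V) u) = Quotient.mk _ v := by
    intro u v
    rcases he with ⟨e, he⟩ | ⟨e, he⟩ <;> rw [he, he, e.injective.eq_iff]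
  have hmem : ∀ {u v}, φ u = φ v ↔ ∃ n : N, (n : Γ.Aut) v = u := by
    intro u v
    rw [hinj, Quotient.eq, MulAction.orbitRel_apply, MulAction.mem_orbit_iff]
    rfl
  have hsurj : Function.Surjective φ := by
    intro i
    rcases he with ⟨e, he⟩ | ⟨e, he⟩ <;>
    · obtain ⟨A, rfl⟩ := e.surjective i
      induction A using Quotient.inductionOn with | _ v
      exact ⟨v, he v⟩
  have hlift : ∀ {u v}, (Γ.orbitQuotient N).Adj (Quotient.mk _ u) (Quotient.mk _ v) ↔
      ∃ u' v', Γ.Adj u' v' ∧ φ u' = φ u ∧ φ v' = φ v := by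
    intro u v
    simp only [hinj, orbitQuotient]
  have hmoveL : ∀ {u v}, (∃ u' v', Γ.Adj u' v' ∧ φ u' = φ u ∧ φ v' = φ v) →
      ∃ w, Γ.Adj u w ∧ φ w = φ v := by
    rintro u v ⟨u', v', hadj, h1, h2⟩
    obtain ⟨n, rfl⟩ := hmem.1 h1.symm
    exact ⟨(n : Γ.Aut) v', (Aut.adj_iff _).2 hadj, (hmem.2 ⟨n, rfl⟩).trans h2⟩
  have hmoveR : ∀ {u v}, (∃ u' v', Γ.Adj u' v' ∧ φ u' = φ u ∧ φ v' = φ v) →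
      ∃ w, Γ.Adj w v ∧ φ w = φ u := by
    rintro u v ⟨u', v', hadj, h1, h2⟩
    obtain ⟨n, rfl⟩ := hmem.1 h2.symm
    exact ⟨(n : Γ.Aut) u', (Aut.adj_iff _).2 hadj, (hmem.2 ⟨n, rfl⟩).trans h1⟩
  have hdich : (Γ.Ascending φ ∧ ∀ v, ∃ w, Γ.Adj w v ∧ φ w = φ v - 1) ∧
      (∀ v, ∃ w, Γ.Adj v w ∧ φ w = φ v + 1) ∨
      (∀ u v, Γ.Adj u v → φ v = φ u + 1 ∨ φ v = φ u - 1) ∧ Γ.TwoWay φ := by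
    rcases he with ⟨e, he⟩ | ⟨e, he⟩
    · have hadj : ∀ {u v}, (Γ.orbitQuotient N).Adj (Quotient.mk _ u) (Quotient.mk _ v) ↔
          φ v = φ u + 1 := by
        intro u v
        rw [← e.map_rel_iff, ← he, ← he]
        rfl
      refine Or.inl ⟨⟨fun u v huv => hadj.1 (hlift.2 ⟨u, v, huv, rfl, rfl⟩), fun v => ?_⟩,
        fun v => ?_⟩
      · obtain ⟨w, hw⟩ := hsurj (φ v - 1)
        rw [← hw]
        exact hmoveR (hlift.1 (hadj.2 (by rw [hw]; ring)))
      · obtain ⟨w, hw⟩ := hsurj (φ v + 1)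
        rw [← hw]
        exact hmoveL (hlift.1 (hadj.2 hw))
    · have hadj : ∀ {u v}, (Γ.orbitQuotient N).Adj (Quotient.mk _ u) (Quotient.mk _ v) ↔
          (φ v = φ u + 1 ∨ φ u = φ v + 1) := by
        intro u v
        rw [← e.map_rel_iff, ← he, ← he]
        rfl
      refine Or.inr ⟨fun u v huv => ?_, fun v => ⟨?_, ?_⟩⟩
      · have := hadj.1 (hlift.2 ⟨u, v, huv, rfl, rfl⟩)
        omega
      · obtain ⟨w, hw⟩ := hsurj (φ v + 1)
        rw [← hw]
        exact hmoveL (hlift.1 (hadj.2 (Or.inl hw)))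
      · obtain ⟨w, hw⟩ := hsurj (φ v - 1)
        rw [← hw]
        exact hmoveL (hlift.1 (hadj.2 (Or.inr (by rw [hw]; ring))))
  have hadj : ∀ u v, Γ.Adj u v → φ v = φ u + 1 ∨ φ v = φ u - 1 := by
    rcases hdich with ⟨⟨h1, -⟩, -⟩ | ⟨h1, -⟩
    exacts [fun u v huv => Or.inl (h1 u v huv), h1]
  have hup : ∀ v, ∃ w, (Γ.Adj v w ∨ Γ.Adj w v) ∧ φ w = φ v + 1 := by
    intro v
    rcases hdich with ⟨-, h1⟩ | ⟨-, h1⟩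
    exacts [(h1 v).imp fun w hw => ⟨Or.inl hw.1, hw.2⟩,
      (h1 v).1.imp fun w hw => ⟨Or.inl hw.1, hw.2⟩]
  have hdown : ∀ v, ∃ w, (Γ.Adj v w ∨ Γ.Adj w v) ∧ φ w = φ v - 1 := by
    intro v
    rcases hdich with ⟨⟨-, h1⟩, -⟩ | ⟨-, h1⟩
    exacts [(h1 v).imp fun w hw => ⟨Or.inr hw.1, hw.2⟩,
      (h1 v).2.imp fun w hw => ⟨Or.inl hw.1, hw.2⟩]
  have hwd : ∀ (g : Γ.Aut) {u v}, φ u = φ v → φ (g u) = φ (g v) := by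
    intro g u v huv
    obtain ⟨n, rfl⟩ := hmem.1 huv
    refine hmem.2 ⟨⟨g * n * g⁻¹, hN.conj_mem _ n.2 g⟩, ?_⟩
    change (g * n * g⁻¹) (g v) = g ((n : Γ.Aut) v)
    rw [Aut.mul_apply, Aut.inv_apply_self, Aut.mul_apply]
  refine ⟨⟨hsurj, fun i => ?_, hadj, hup, hdown, fun g => ?_, fun u v huv => ?_⟩, ?_⟩
  · obtain ⟨v, rfl⟩ := hsurj i
    refine (hfin v).subset fun u hu => ?_
    obtain ⟨n, hn⟩ := hmem.1 (show φ u = φ v from hu)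
    exact ⟨n, hn⟩
  · choose s hs using hsurj
    have hσ : ∀ v, φ (g (s (φ v))) = φ (g v) := fun v => hwd g (hs _)
    obtain ⟨ε, hε, hlin⟩ := eq_add_mul_of_adjacent (σ := fun i => φ (g (s i))) (by
        intro i j hij
        have := hwd g⁻¹ hij
        rwa [Aut.inv_apply_self, Aut.inv_apply_self, hs, hs] at this) (by
        intro i
        obtain ⟨w, hw, hw'⟩ := hup (s i)
        rw [hs] at hw'
        have h1 := hσ w
        rw [hw'] at h1
        simp only [h1]
        rcases hw with hw | hw
        · exact hadj _ _ (g.adj_iff.2 hw)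
        · have := hadj _ _ (g.adj_iff.2 hw)
          omega)
    have hsc : Scales φ ε g := by
      intro u v
      rw [← hσ u, ← hσ v]
      have h1 := hlin (φ u)
      have h2 := hlin (φ v)
      rw [h1, h2]
      ring
    rcases hε with rfl | rfl
    exacts [Or.inl hsc, Or.inr hsc]
  · obtain ⟨n, hn⟩ := hmem.1 huv.symm
    exact ⟨n, hn, fun w => hmem.2 ⟨n, rfl⟩⟩
  · rcases hdich with ⟨⟨h1, -⟩, -⟩ | ⟨-, h1⟩
    exacts [Or.inl h1, Or.inr h1]

/-! ### The fibre size -/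

namespace IsHeight

theorem image_fibre (h : Γ.IsHeight φ) (g : Γ.Aut) (v : V) :
    g '' (φ ⁻¹' {φ v}) = φ ⁻¹' {φ (g v)} := by
  ext x
  constructor
  · rintro ⟨y, hy, rfl⟩
    exact (h.apply_eq_apply_iff g).2 hy
  · intro hx
    refine ⟨g⁻¹ x, ?_, Aut.apply_inv_self g x⟩
    change φ _ = φ v
    rw [← h.apply_eq_apply_iff g, Aut.apply_inv_self]
    exact hx

theorem exists_fibre_card (h : Γ.IsHeight φ) (hvert : Γ.VertexTransitive) :
    ∃ m : ℕ, ∀ i, (φ ⁻¹' {i}).encard = m := by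
  refine ⟨(φ ⁻¹' {0}).ncard, fun i => ?_⟩
  rw [(h.finite_fibre 0).cast_ncard_eq]
  obtain ⟨a, ha⟩ := h.surjective 0
  obtain ⟨b, rfl⟩ := h.surjective i
  obtain ⟨g, rfl⟩ := hvert a b
  rw [← h.image_fibre, g.injective.encard_image, ha]

/-- By transitivity `φ'` varies by at most a uniform `C` on the fibres of `φ`. Climbing one
`φ`-level along an edge changes `φ'` by one. -/
theorem exists_abs_sub_le (h : Γ.IsHeight φ) (h' : Γ.IsHeight φ') (hvert : Γ.VertexTransitive) :
    ∃ C : ℕ, ∀ u v, |φ' u - φ' v| ≤ |φ u - φ v| + C := by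
  obtain ⟨a, ha⟩ := h.surjective 0
  obtain ⟨C, hC⟩ : ∃ C : ℕ, ∀ x, φ x = 0 → |φ' a - φ' x| ≤ C := by
    obtain ⟨C, hC⟩ := ((h.finite_fibre 0).image fun x => |φ' a - φ' x|).bddAbove
    exact ⟨C.toNat, fun x hx => (hC ⟨x, hx, rfl⟩).trans (Int.self_le_toNat C)⟩
  have hfibre : ∀ u v, φ u = φ v → |φ' u - φ' v| ≤ C := by
    intro u v huv
    obtain ⟨g, rfl⟩ := hvert u a
    rw [← h'.abs_sub_apply g]
    exact hC _ (by rw [← ha, h.apply_eq_apply_iff, huv])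
  have hpath : ∀ (n : ℕ) (u : V), ∃ w, φ w = φ u + n ∧ |φ' u - φ' w| ≤ n := by
    intro n u
    induction n with
    | zero => exact ⟨u, by simp, by simp⟩
    | succ n ih =>
      obtain ⟨w, hw, hw'⟩ := ih
      obtain ⟨x, hx, hx'⟩ := h.up w
      refine ⟨x, by push_cast; rw [hx', hw]; ring, ?_⟩
      have hwx : φ' x = φ' w + 1 ∨ φ' x = φ' w - 1 := by
        rcases hx with hx | hx
        · exact h'.adj _ _ hx
        · have := h'.adj _ _ hx
          omega
      push_cast
      rw [abs_le] at hw' ⊢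
      omega
  have hle : ∀ u v, φ u ≤ φ v → |φ' u - φ' v| ≤ |φ u - φ v| + C := by
    intro u v huv
    obtain ⟨w, hw, hw'⟩ := hpath (φ v - φ u).toNat u
    have hn : ((φ v - φ u).toNat : ℤ) = φ v - φ u := Int.toNat_of_nonneg (sub_nonneg.2 huv)
    rw [hn] at hw hw'
    have h1 := hfibre w v (by rw [hw]; ring)
    rw [abs_sub_comm (φ u), abs_of_nonneg (sub_nonneg.2 huv)]
    have := abs_sub_le (φ' u) (φ' w) (φ' v)
    linarith
  refine ⟨C, fun u v => ?_⟩
  rcases le_total (φ u) (φ v) with huv | huv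
  · exact hle u v huv
  · rw [abs_sub_comm (φ' u), abs_sub_comm (φ u)]
    exact hle v u huv

theorem fibre_card_le (h : Γ.IsHeight φ) (h' : Γ.IsHeight φ') (hvert : Γ.VertexTransitive)
    {m m' : ℕ} (hm : ∀ i, (φ ⁻¹' {i}).encard = m) (hm' : ∀ i, (φ' ⁻¹' {i}).encard = m') :
    m ≤ m' := by
  classical
  obtain ⟨C, hC⟩ := h.exists_abs_sub_le h' hvert
  have hcard : ∀ {φ : V → ℤ} (h : Γ.IsHeight φ) {m : ℕ}, (∀ i, (φ ⁻¹' {i}).encard = m) →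
      ∀ (b : ℤ) (n : ℕ), ((Finset.Icc (b - n) (b + n)).biUnion
        fun i => (h.finite_fibre i).toFinset).card = (2 * n + 1) * m := by
    intro φ h m hm b n
    rw [Finset.card_biUnion]
    · have : ∀ i, ((h.finite_fibre i).toFinset).card = m := by
        intro i
        have := (h.finite_fibre i).encard_eq_coe_toFinset_card
        rw [hm] at this
        exact_mod_cast this.symm
      rw [Finset.sum_congr rfl fun i _ => this i, Finset.sum_const, Int.card_Icc, smul_eq_mul]
      congr 1
      omega
    · intro i _ j _ hij
      rw [Function.onFun, Finset.disjoint_left]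
      intro x hx hx'
      simp only [Set.Finite.mem_toFinset, Set.mem_preimage, Set.mem_singleton_iff] at hx hx'
      exact hij (hx.symm.trans hx')
  obtain ⟨a, -⟩ := h.surjective 0
  by_contra! hlt
  -- A window of radius `n` for `φ` lies in one of radius `n + C` for `φ'`. With `n = C * m'` and `m
  -- ≥ m' + 1` the resulting inequality of cardinalities fails by exactly one.
  have hsub : (Finset.Icc (φ a - (C * m' : ℕ)) (φ a + (C * m' : ℕ))).biUnion
      (fun i => (h.finite_fibre i).toFinset) ⊆
      (Finset.Icc (φ' a - (C * m' + C : ℕ)) (φ' a + (C * m' + C : ℕ))).biUnion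
        fun i => (h'.finite_fibre i).toFinset := by
    intro x hx
    simp only [Finset.mem_biUnion, Finset.mem_Icc, Set.Finite.mem_toFinset, Set.mem_preimage,
      Set.mem_singleton_iff, exists_eq_right'] at hx ⊢
    have h1 := hC x a
    have h2 : |φ x - φ a| ≤ (C * m' : ℕ) := by
      rw [abs_le]
      constructor <;> linarith
    have h3 : |φ' x - φ' a| ≤ (C * m' + C : ℕ) := by
      push_cast at h2 ⊢
      linarith
    rw [abs_le] at h3
    constructor <;> linarith
  have hle := Finset.card_le_card hsub
  rw [hcard h hm, hcard h' hm'] at hle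
  have : (2 * (C * m') + 1) * (m' + 1) ≤ (2 * (C * m' + C) + 1) * m' :=
    (Nat.mul_le_mul_left _ hlt).trans hle
  nlinarith

end IsHeight

theorem existsUnique_isFibreSize (hends : Γ.TwoEnded) (hvert : Γ.VertexTransitive)
    (harc : Γ.ArcTransitive) : ∃! m : ℕ, Γ.IsFibreSize m := by
  obtain ⟨φ, h, hφ⟩ := exists_isHeight hends hvert harc
  obtain ⟨m, hm⟩ := h.exists_fibre_card hvert
  refine ⟨m, ⟨φ, h.isLineProjection hφ, hm⟩, ?_⟩
  rintro m' ⟨φ', hφ', hm'⟩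
  have h' := hφ'.isHeight.1
  exact le_antisymm (h'.fibre_card_le h hvert hm' hm) (h.fibre_card_le h' hvert hm hm')

/-! ### Normal subgroups of vertex stabilizers -/

/-- A normal subgroup of a vertex stabilizer that acts quasi-primitively on the out-neighbours
acts trivially or transitively on them. -/
theorem fixes_or_transitive_of_isQuasiPreprimitive {v : V}
    (hqp : MulAction.IsQuasiPreprimitive (Γ.vertexStabilizer v) (Γ.outNeighbours v))
    {M : Subgroup Γ.Aut} (hM : ∀ n ∈ M, n v = v)
    (hnorm : ∀ g : Γ.Aut, g v = v → ∀ n ∈ M, g * n * g⁻¹ ∈ M) :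
    (∀ n ∈ M, ∀ w, Γ.Adj v w → n w = w) ∨
      ∀ w w', Γ.Adj v w → Γ.Adj v w' → ∃ n ∈ M, n w = w' := by
  have : (M.subgroupOf (Γ.vertexStabilizer v)).Normal := ⟨fun n hn g => hnorm g.1 g.2 n.1 hn⟩
  by_cases hfix : MulAction.fixedPoints (M.subgroupOf (Γ.vertexStabilizer v))
      (Γ.outNeighbours v) = Set.univ
  · left
    intro n hn w hw
    have hmem : (⟨w, hw⟩ : Γ.outNeighbours v) ∈ MulAction.fixedPoints
        (M.subgroupOf (Γ.vertexStabilizer v)) (Γ.outNeighbours v) := hfix ▸ Set.mem_univ _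
    exact congrArg Subtype.val (hmem ⟨⟨n, hM n hn⟩, hn⟩)
  · right
    intro w w' hw hw'
    have := hqp.isPretransitive_of_normal hfix
    obtain ⟨n, hn⟩ := MulAction.exists_smul_eq (M.subgroupOf (Γ.vertexStabilizer v))
      (⟨w, hw⟩ : Γ.outNeighbours v) ⟨w', hw'⟩
    exact ⟨n.1.1, n.2, congrArg Subtype.val hn⟩

/-- Arc-transitivity makes the local action transitive, and a transitive action of prime degree is
primitive. -/
theorem isQuasiPreprimitive_of_prime (harc : Γ.ArcTransitive) {p : ℕ} (hp : p.Prime)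
    (hval : Γ.HasOutValency p) (v : V) :
    MulAction.IsQuasiPreprimitive (Γ.vertexStabilizer v) (Γ.outNeighbours v) := by
  have : MulAction.IsPretransitive (Γ.vertexStabilizer v) (Γ.outNeighbours v) := by
    refine ⟨fun w w' => ?_⟩
    obtain ⟨g, hg, hg'⟩ := harc v w.1 v w'.1 w.2 w'.2
    exact ⟨⟨g, hg⟩, Subtype.ext hg'⟩
  have hcard : Nat.card (Γ.outNeighbours v) = p := by
    have h1 : Nat.card (Γ.outNeighbours v) = {w | Γ.Adj v w}.ncard := rfl
    rw [h1, Set.ncard_def, hval v]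
    rfl
  have := MulAction.IsPreprimitive.of_prime_card (G := Γ.vertexStabilizer v)
    (X := Γ.outNeighbours v) (hcard ▸ hp)
  infer_instance

/-! ### Pointwise stabilizers in the level group -/

/-- The automorphisms that preserve all the values of `φ` and fix all the vertices in `s`. -/
def levelFix (Γ : Digraph V) (φ : V → ℤ) (s : Set V) : Subgroup Γ.Aut :=
  Γ.levelGroup φ ⊓ ⨅ x : s, MulAction.stabilizer Γ.Aut (x : V)

theorem mem_levelFix {s : Set V} {g : Γ.Aut} :
    g ∈ Γ.levelFix φ s ↔ (∀ v, φ (g v) = φ v) ∧ ∀ x ∈ s, g x = x := by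
  rw [levelFix, Subgroup.mem_inf, mem_levelGroup, Subgroup.mem_iInf]
  exact and_congr Iff.rfl Subtype.forall

/-- A subgroup contained in a conjugate of itself of the same finite index is equal to it. -/
theorem _root_.Subgroup.map_conj_le_of_le {G : Type*} [Group G] {H K : Subgroup G} {t : G}
    (hK : K.Normal) (hHK : H ≤ K) (hfin : H.relIndex K ≠ 0)
    (hle : H ≤ H.map (MulAut.conj t).toMonoidHom) : H.map (MulAut.conj t).toMonoidHom ≤ H := by
  have hKt : K.map (MulAut.conj t).toMonoidHom = K := Subgroup.Normal.map_conj_eq K t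
  have hHK' : H.map (MulAut.conj t).toMonoidHom ≤ K := hKt ▸ Subgroup.map_mono hHK
  have h1 := Subgroup.relIndex_mul_relIndex _ _ _ hle hHK'
  have h2 := Subgroup.relIndex_map_map_of_injective H K
    (f := (MulAut.conj t).toMonoidHom) (MulAut.conj t).injective
  rw [hKt] at h2
  rw [h2] at h1
  exact Subgroup.relIndex_eq_one.1 (Nat.eq_of_mul_eq_mul_right (Nat.pos_of_ne_zero hfin)
    (h1.trans (one_mul _).symm))

namespace IsHeight

theorem relIndex_levelFix_ne_zero (h : Γ.IsHeight φ) {s : Set V} (hs : s.Finite) :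
    (Γ.levelFix φ s).relIndex (Γ.levelGroup φ) ≠ 0 := by
  have := hs.to_subtype
  refine Subgroup.relIndex_inf_ne_zero (by simp) (Subgroup.relIndex_iInf_ne_zero fun x => ?_)
  have e : (MulAction.stabilizer Γ.Aut (x : V)).subgroupOf (Γ.levelGroup φ) =
      MulAction.stabilizer (Γ.levelGroup φ) (x : V) := rfl
  rw [Subgroup.relIndex, e, MulAction.index_stabilizer]
  have hfin : (MulAction.orbit (Γ.levelGroup φ) (x : V)).Finite := by
    refine (h.finite_fibre (φ x)).subset ?_
    rintro _ ⟨n, rfl⟩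
    exact n.2 x
  exact Set.ncard_ne_zero_of_mem (MulAction.mem_orbit_self _) hfin

theorem levelFix_image (h : Γ.IsHeight φ) (t : Γ.Aut) (s : Set V) :
    Γ.levelFix φ (t '' s) = (Γ.levelFix φ s).map (MulAut.conj t).toMonoidHom := by
  have hconj : ∀ (t g : Γ.Aut), (∀ v, φ (g v) = φ v) → ∀ v, φ ((t * g * t⁻¹) v) = φ v :=
    fun t g hg => h.levelGroup_normal.conj_mem g hg t
  ext g
  rw [Subgroup.mem_map, mem_levelFix]
  constructor
  · rintro ⟨hg, hgs⟩
    refine ⟨t⁻¹ * g * t⁻¹⁻¹, mem_levelFix.2 ⟨hconj _ _ hg, fun x hx => ?_⟩, ?_⟩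
    · rw [inv_inv, Aut.mul_apply, Aut.mul_apply, hgs _ ⟨x, hx, rfl⟩, Aut.inv_apply_self]
    · change t * (t⁻¹ * g * t⁻¹⁻¹) * t⁻¹ = g
      group
  · rintro ⟨n, hn, rfl⟩
    rw [mem_levelFix] at hn
    refine ⟨hconj t n hn.1, ?_⟩
    rintro _ ⟨x, hx, rfl⟩
    change (t * n * t⁻¹) (t x) = t x
    rw [Aut.mul_apply, Aut.inv_apply_self, Aut.mul_apply, hn.2 x hx]

/-- The two groups are conjugate and have the same finite index in the normal level group, so one
cannot properly contain the other. -/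
theorem levelFix_image_eq (h : Γ.IsHeight φ) {s : Set V} (hs : s.Finite) (t : Γ.Aut)
    (hle : Γ.levelFix φ s ≤ Γ.levelFix φ (t '' s)) :
    Γ.levelFix φ (t '' s) = Γ.levelFix φ s := by
  refine le_antisymm ?_ hle
  rw [h.levelFix_image] at hle ⊢
  exact Subgroup.map_conj_le_of_le h.levelGroup_normal inf_le_left
    (h.relIndex_levelFix_ne_zero hs) hle

theorem eq_one_of_forall_apply_eq {g : Γ.Aut} (hg : ∀ v, g v = v) : g = 1 :=
  RelIso.ext hg

theorem levelFix_conj_mem (h : Γ.IsHeight φ) {s : Set V} {g n : Γ.Aut} (hg : g '' s = s)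
    (hn : n ∈ Γ.levelFix φ s) : g * n * g⁻¹ ∈ Γ.levelFix φ s := by
  rw [← hg, h.levelFix_image]
  exact ⟨n, hn, rfl⟩

/-! ### The two-way case -/

/-- `levelFix φ {u}` is normalized by `G_u` and cannot take an out-neighbour above to one below, so
it fixes all out-neighbours. By the index argument it is then the same group along every arc, hence
trivial. The sign of its action on heights determines an element of `G_v`. -/
theorem card_stabilizer_le_two (h : Γ.IsHeight φ) (hconn : Γ.underlying.Connected)
    (hvert : Γ.VertexTransitive) (htwo : Γ.TwoWay φ)
    (hqp : ∀ v, MulAction.IsQuasiPreprimitive (Γ.vertexStabilizer v) (Γ.outNeighbours v))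
    (v : V) : ENat.card (Γ.vertexStabilizer v) ≤ 2 := by
  have hadj : ∀ u w, Γ.Adj u w → Γ.levelFix φ {w} = Γ.levelFix φ {u} := by
    intro u w huw
    have hfix : ∀ n ∈ Γ.levelFix φ {u}, ∀ w, Γ.Adj u w → n w = w := by
      refine (fixes_or_transitive_of_isQuasiPreprimitive (hqp u)
        (M := Γ.levelFix φ {u}) (fun n hn => (mem_levelFix.1 hn).2 u rfl)
        (fun g hg n hn => h.levelFix_conj_mem (by rw [Set.image_singleton, hg]) hn)).resolve_right
        fun htr => ?_
      obtain ⟨⟨x, hx, hx'⟩, y, hy, hy'⟩ := htwo u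
      obtain ⟨n, hn, rfl⟩ := htr x y hx hy
      rw [(mem_levelFix.1 hn).1] at hy'
      omega
    obtain ⟨t, rfl⟩ := hvert u w
    rw [← Set.image_singleton]
    refine h.levelFix_image_eq (Set.finite_singleton u) t fun n hn => ?_
    rw [Set.image_singleton, mem_levelFix]
    refine ⟨(mem_levelFix.1 hn).1, ?_⟩
    rintro _ rfl
    exact hfix n hn _ huw
  have htriv : ∀ n ∈ Γ.levelFix φ {v}, n = 1 := by
    intro n hn
    refine eq_one_of_forall_apply_eq fun x => ?_
    have hx := connected_induction hconn (P := fun x => n ∈ Γ.levelFix φ {x}) hn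
      (fun u w huw => by rw [hadj u w huw]) x
    exact (mem_levelFix.1 hx).2 x rfl
  have hinj : Function.Injective
      fun g : Γ.vertexStabilizer v => (Scales φ 1 g.1 : Prop) := by
    intro g k hgk
    have hgk' : Scales φ 1 g.1 = Scales φ 1 k.1 := hgk
    have hsc : Scales φ 1 (k.1⁻¹ * g.1) := by
      by_cases hg : Scales φ 1 g.1
      · have hk : Scales φ 1 k.1 := hgk' ▸ hg
        simpa using (hk.inv (by norm_num)).mul hg
      · have hk : ¬ Scales φ 1 k.1 := fun hk => hg (hgk' ▸ hk)
        simpa using (((h.scales k.1).resolve_left hk).inv (by norm_num)).mul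
          ((h.scales g.1).resolve_left hg)
    have hv : (k.1⁻¹ * g.1) v = v := (k⁻¹ * g).2
    have := htriv (k.1⁻¹ * g.1) (mem_levelFix.2 ⟨fun x => ?_, ?_⟩)
    · exact Subtype.ext (inv_mul_eq_one.1 this).symm
    · have := hsc x v
      rw [hv] at this
      linarith
    · rintro _ rfl
      exact hv
  refine (ENat.card_le_card_of_injective hinj).trans ?_
  simp

/-! ### The ascending case -/

theorem scales_one (h : Γ.IsHeight φ) (hasc : Γ.Ascending φ) (g : Γ.Aut) : Scales φ 1 g := by
  refine (h.scales g).resolve_right fun hg => ?_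
  obtain ⟨a, -⟩ := h.surjective 0
  obtain ⟨w, hw | hw, -⟩ := h.up a
  · have h1 := hasc _ _ hw
    have h2 := hasc _ _ (g.adj_iff.2 hw)
    have h3 := hg w a
    omega
  · have h1 := hasc _ _ hw
    have h2 := hasc _ _ (g.adj_iff.2 hw)
    have h3 := hg w a
    omega

theorem mem_levelGroup_of_apply_eq (h : Γ.IsHeight φ) (hasc : Γ.Ascending φ) {g : Γ.Aut} {v : V}
    (hg : φ (g v) = φ v) (w : V) :
    φ (g w) = φ w := by
  have := h.scales_one hasc g w v
  linarith

/-- An automorphism that fixes a fibre pointwise can be replaced by the identity below it. -/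
theorem _root_.Digraph.Ascending.exists_glue (hasc : Γ.Ascending φ) {i : ℤ} {n : Γ.Aut}
    (hn : n ∈ Γ.levelFix φ (φ ⁻¹' {i})) :
    ∃ k : Γ.Aut, (∀ x, φ x ≤ i → k x = x) ∧ ∀ x, i < φ x → k x = n x := by
  -- Only arcs from level `i` to level `i + 1` straddle the cut, and `n` fixes their tails.
  have key : ∀ n ∈ Γ.levelFix φ (φ ⁻¹' {i}), ∀ x y, Γ.Adj x y →
      Γ.Adj (if φ x ≤ i then x else n x) (if φ y ≤ i then y else n y) := by
    intro n hn x y hxy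
    rw [mem_levelFix] at hn
    have h1 := hasc x y hxy
    split_ifs with hx hy hy
    · exact hxy
    · have hnx : n x = x := hn.2 x (show φ x = i by omega)
      rw [← hnx]
      exact n.adj_iff.2 hxy
    · omega
    · exact n.adj_iff.2 hxy
  have hinv : ∀ n ∈ Γ.levelFix φ (φ ⁻¹' {i}), ∀ x,
      (if φ (if φ x ≤ i then x else n x) ≤ i then (if φ x ≤ i then x else n x)
        else n⁻¹ (if φ x ≤ i then x else n x)) = x := by
    intro n hn x
    rw [mem_levelFix] at hn
    by_cases hx : φ x ≤ i
    · simp [hx]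
    · rw [if_neg hx, hn.1, if_neg hx, Aut.inv_apply_self]
  let e : V ≃ V :=
    { toFun := fun x => if φ x ≤ i then x else n x
      invFun := fun x => if φ x ≤ i then x else n⁻¹ x
      left_inv := hinv n hn
      right_inv := fun x => by
        have := hinv n⁻¹ (inv_mem hn) x
        rwa [inv_inv] at this }
  refine ⟨⟨e, fun {x y} => ⟨fun hxy => ?_, key n hn x y⟩⟩, fun x hx => if_pos hx,
    fun x hx => if_neg (not_le.2 hx)⟩
  have := key n⁻¹ (inv_mem hn) _ _ hxy
  have h1 : ∀ x, (if φ (e x) ≤ i then e x else n⁻¹ (e x)) = x := e.left_inv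
  rwa [h1, h1] at this

theorem _root_.Digraph.Ascending.apply_le_apply_last (hasc : Γ.Ascending φ) {k : ℕ}
    {s : Fin (k + 1) → V} (hs : Γ.IsKArc k s) (i : Fin (k + 1)) :
    φ (s i) ≤ φ (s (Fin.last k)) := by
  induction i using Fin.reverseInduction with
  | last => exact le_rfl
  | cast i ih =>
    have := hasc _ _ (hs i)
    omega

/-- Once the first `k + 1` vertices agree, an element fixing the fibre of the last of them corrects
the new end. Glued to the identity below, it leaves the earlier vertices in place. -/
theorem _root_.Digraph.Ascending.highlyArcTransitive (hasc : Γ.Ascending φ)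
    (hvert : Γ.VertexTransitive) (htr : ∀ v w w', Γ.Adj v w → Γ.Adj v w' →
      ∃ n ∈ Γ.levelFix φ (φ ⁻¹' {φ v}), n w = w') : Γ.HighlyArcTransitive := by
  intro k
  induction k with
  | zero =>
    intro s t _ _
    obtain ⟨g, hg⟩ := hvert (s 0) (t 0)
    refine ⟨g, fun i => ?_⟩
    rw [Fin.fin_one_eq_zero i]
    exact hg
  | succ k ih =>
    intro s t hs ht
    have hs' : Γ.IsKArc k fun i => s i.castSucc := fun i => hs i.castSucc
    have ht' : Γ.IsKArc k fun i => t i.castSucc := fun i => ht i.castSucc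
    obtain ⟨g, hg⟩ := ih _ _ hs' ht'
    have h1 : Γ.Adj (t (Fin.last k).castSucc) (g (s (Fin.last (k + 1)))) := by
      rw [← hg]
      exact g.adj_iff.2 (hs (Fin.last k))
    have h2 : Γ.Adj (t (Fin.last k).castSucc) (t (Fin.last (k + 1))) := ht (Fin.last k)
    obtain ⟨n, hn, hn'⟩ := htr _ _ _ h1 h2
    obtain ⟨l, hl, hl'⟩ := hasc.exists_glue hn
    refine ⟨l * g, fun i => ?_⟩
    rw [Aut.mul_apply]
    induction i using Fin.lastCases with
    | last =>
      rw [hl' _ (by have := hasc _ _ h1; omega), hn']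
    | cast i =>
      rw [hg i, hl _ (hasc.apply_le_apply_last ht' i)]

/-- If transitivity fails at `v`, the stabilizer of its fibre fixes the out-neighbours of `v`. Being
normalized by the level group, it does so for the whole fibre, and so fixes the next fibre
pointwise. The index argument makes the two fibre stabilizers equal; by translation all are equal,
hence trivial. -/
theorem levelFix_fibre_eq_bot_or_transitive (h : Γ.IsHeight φ) (hasc : Γ.Ascending φ)
    (hvert : Γ.VertexTransitive)
    (hqp : ∀ v, MulAction.IsQuasiPreprimitive (Γ.vertexStabilizer v) (Γ.outNeighbours v)) :
    (∀ i, Γ.levelFix φ (φ ⁻¹' {i}) = ⊥) ∨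
      ∀ v w w', Γ.Adj v w → Γ.Adj v w' → ∃ n ∈ Γ.levelFix φ (φ ⁻¹' {φ v}), n w = w' := by
  rw [or_iff_not_imp_right]
  intro hno
  obtain ⟨v, hv⟩ := not_forall.1 hno
  have hfix := (fixes_or_transitive_of_isQuasiPreprimitive (hqp v)
    (M := Γ.levelFix φ (φ ⁻¹' {φ v})) (fun n hn => (mem_levelFix.1 hn).2 v rfl)
    (fun g hg n hn => h.levelFix_conj_mem (by rw [h.image_fibre, hg]) hn)).resolve_right hv
  -- the pointwise stabilizer of the fibre of `v` fixes the next fibre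
  have hle : Γ.levelFix φ (φ ⁻¹' {φ v}) ≤ Γ.levelFix φ (φ ⁻¹' {φ v + 1}) := by
    intro n hn
    refine mem_levelFix.2 ⟨(mem_levelFix.1 hn).1, fun w hw => ?_⟩
    have hw' : φ w = φ v + 1 := hw
    obtain ⟨u, hu, hu'⟩ : ∃ u, Γ.Adj u w ∧ φ u = φ v := by
      obtain ⟨u, hu | hu, hu'⟩ := h.down w
      · have := hasc _ _ hu
        omega
      · exact ⟨u, hu, by omega⟩
    obtain ⟨k, rfl, hk⟩ := h.trans v u hu'.symm
    have h1 : k⁻¹ * n * k⁻¹⁻¹ ∈ Γ.levelFix φ (φ ⁻¹' {φ v}) := by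
      refine h.levelFix_conj_mem ?_ hn
      rw [h.image_fibre, (inv_mem (mem_levelGroup.2 hk) : k⁻¹ ∈ Γ.levelGroup φ) v]
    have h2 := hfix _ h1 (k⁻¹ w) (by rw [← k.adj_iff, Aut.apply_inv_self]; exact hu)
    rw [inv_inv, Aut.mul_apply, Aut.mul_apply, Aut.apply_inv_self] at h2
    exact k⁻¹.injective h2
  obtain ⟨w, hw⟩ : ∃ w, φ w = φ v + 1 := h.surjective _
  obtain ⟨t, rfl⟩ := hvert v w
  have hshift : ∀ x, φ (t x) = φ x + 1 := by
    intro x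
    have := h.scales_one hasc t x v
    linarith
  have himage : ∀ (g : Γ.Aut) (j : ℤ), (∀ x, φ (g x) = φ x + j) → ∀ i,
      g '' (φ ⁻¹' {i}) = φ ⁻¹' {i + j} := by
    intro g j hg i
    obtain ⟨x, rfl⟩ := h.surjective i
    rw [h.image_fibre, hg]
  have heq : Γ.levelFix φ (φ ⁻¹' {φ v + 1}) = Γ.levelFix φ (φ ⁻¹' {φ v}) := by
    rw [← himage t 1 hshift] at hle ⊢
    exact h.levelFix_image_eq (h.finite_fibre _) t hle
  have hall : ∀ i, Γ.levelFix φ (φ ⁻¹' {i + 1}) = Γ.levelFix φ (φ ⁻¹' {i}) := by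
    intro i
    obtain ⟨x, hx⟩ := h.surjective i
    obtain ⟨g, rfl⟩ := hvert v x
    have hg : ∀ y, φ (g y) = φ y + (i - φ v) := by
      intro y
      have := h.scales_one hasc g y v
      linarith
    have e1 := himage g _ hg (φ v)
    have e2 := himage g _ hg (φ v + 1)
    rw [show φ v + (i - φ v) = i by ring] at e1
    rw [show φ v + 1 + (i - φ v) = i + 1 by ring] at e2
    rw [← e1, ← e2, h.levelFix_image, h.levelFix_image, heq]
  have hconst : ∀ i, Γ.levelFix φ (φ ⁻¹' {i}) = Γ.levelFix φ (φ ⁻¹' {0}) := by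
    intro i
    induction i with
    | zero => rfl
    | succ k ih => rw [hall, ih]
    | pred k ih => rw [← ih, ← hall (-(k : ℤ) - 1), sub_add_cancel]
  intro i
  rw [eq_bot_iff]
  intro n hn
  refine Subgroup.mem_bot.2 (eq_one_of_forall_apply_eq fun x => ?_)
  rw [hconst, ← hconst (φ x)] at hn
  exact (mem_levelFix.1 hn).2 x rfl

/-- `G_v` permutes the `m - 1` other vertices of its fibre, and the kernel fixes the fibre
pointwise. -/
theorem card_stabilizer_le_factorial (h : Γ.IsHeight φ) (hasc : Γ.Ascending φ) {m : ℕ}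
    (hm : ∀ i, (φ ⁻¹' {i}).encard = m) (hbot : ∀ i, Γ.levelFix φ (φ ⁻¹' {i}) = ⊥) (v : V) :
    ENat.card (Γ.vertexStabilizer v) ≤ ((m - 1).factorial : ℕ∞) := by
  classical
  let p : V → Prop := fun x => x ∈ φ ⁻¹' {φ v} \ {v}
  have hlevel : ∀ (g : Γ.vertexStabilizer v) x, φ (g.1 x) = φ x := fun g =>
    h.mem_levelGroup_of_apply_eq hasc (congrArg φ (show g.1 v = v from g.2))
  have hp : ∀ (g : Γ.vertexStabilizer v) x, p (g.1 x) ↔ p x := by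
    intro g x
    have hg : g.1 v = v := g.2
    refine and_congr ?_ (not_congr ?_)
    · simp only [Set.mem_preimage, Set.mem_singleton_iff, hlevel]
    · simp only [Set.mem_singleton_iff]
      exact ⟨fun hx => g.1.injective (hx.trans hg.symm), fun hx => hx ▸ hg⟩
  have hinj : Function.Injective fun g : Γ.vertexStabilizer v =>
      Equiv.Perm.subtypePerm (p := p) g.1.toEquiv (hp g) := by
    intro g k hgk
    have hmem : k.1⁻¹ * g.1 ∈ Γ.levelFix φ (φ ⁻¹' {φ v}) := by
      refine mem_levelFix.2 ⟨hlevel (k⁻¹ * g), fun x hx => ?_⟩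
      by_cases hxv : x = v
      · rw [hxv]
        exact (k⁻¹ * g).2
      · have h1 : g.1 x = k.1 x :=
          congrArg Subtype.val (DFunLike.congr_fun hgk (⟨x, hx, hxv⟩ : {x // p x}))
        rw [Aut.mul_apply, h1, Aut.inv_apply_self]
    rw [hbot, Subgroup.mem_bot] at hmem
    exact Subtype.ext (inv_mul_eq_one.1 hmem).symm
  have hfin : (φ ⁻¹' {φ v} \ {v}).Finite := (h.finite_fibre _).subset Set.sdiff_subset
  have : Finite {x // p x} := hfin.to_subtype
  have hcard : Nat.card {x // p x} = m - 1 := by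
    have h1 : Nat.card {x // p x} = (φ ⁻¹' {φ v} \ {v}).ncard := rfl
    have h2 : v ∈ φ ⁻¹' {φ v} := rfl
    rw [h1, Set.ncard_sdiff_singleton_of_mem h2, Set.ncard_def, hm]
    rfl
  refine (ENat.card_le_card_of_injective hinj).trans ?_
  rw [ENat.card_eq_coe_natCard, Nat.card_perm, hcard]

/-- A digraph over the line that is quasi-primitive on out-neighbours and has large vertex
stabilizers is highly-arc-transitive. -/
theorem highlyArcTransitive (h : Γ.IsHeight φ) (hφ : Γ.Ascending φ ∨ Γ.TwoWay φ)
    (hconn : Γ.underlying.Connected) (hvert : Γ.VertexTransitive)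
    (hqp : ∀ v, MulAction.IsQuasiPreprimitive (Γ.vertexStabilizer v) (Γ.outNeighbours v))
    {m : ℕ} (hm : ∀ i, (φ ⁻¹' {i}).encard = m) {v : V}
    (hv : (2 < m ∧ ((m - 1).factorial : ℕ∞) < ENat.card (Γ.vertexStabilizer v)) ∨
      Infinite (Γ.vertexStabilizer v)) : Γ.HighlyArcTransitive := by
  rcases hφ with hasc | htwo
  · rcases h.levelFix_fibre_eq_bot_or_transitive hasc hvert hqp with hbot | htr
    · have hle := h.card_stabilizer_le_factorial hasc hm hbot v
      rcases hv with ⟨-, hlt⟩ | hinf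
      · exact absurd hle (not_le.2 hlt)
      · rw [ENat.card_eq_top_of_infinite, top_le_iff] at hle
        exact absurd hle (ENat.natCast_ne_top _)
    · exact hasc.highlyArcTransitive hvert htr
  · have hle := h.card_stabilizer_le_two hconn hvert htwo hqp v
    rcases hv with ⟨hm2, hlt⟩ | hinf
    · have h2 : 2 ≤ (m - 1).factorial :=
        (show 2 ≤ m - 1 by omega).trans (Nat.self_le_factorial _)
      have h3 : (2 : ℕ∞) ≤ ((m - 1).factorial : ℕ∞) := by exact_mod_cast h2
      exact absurd (hle.trans h3) (not_le.2 hlt)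
    · rw [ENat.card_eq_top_of_infinite, top_le_iff] at hle
      exact absurd hle (ENat.natCast_ne_top 2)

end IsHeight

/-- The common core of (a) and (b), which differ only in how quasi-primitivity on out-neighbours is
obtained. -/
theorem highlyArcTransitive_of_isQuasiPreprimitive (hends : Γ.TwoEnded)
    (hvert : Γ.VertexTransitive) (harc : Γ.ArcTransitive)
    (hqp : ∀ v, MulAction.IsQuasiPreprimitive (Γ.vertexStabilizer v) (Γ.outNeighbours v)) :
    (∀ m : ℕ, Γ.IsFibreSize m → 2 < m → ∀ v : V,
      ((m - 1).factorial : ℕ∞) < ENat.card (Γ.vertexStabilizer v) → Γ.HighlyArcTransitive) ∧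
    (∀ v : V, Infinite (Γ.vertexStabilizer v) → Γ.HighlyArcTransitive) := by
  constructor
  · rintro m ⟨φ, hφ, hm⟩ hm2 v hv
    obtain ⟨h, hdir⟩ := hφ.isHeight
    exact h.highlyArcTransitive hdir hends.1 hvert hqp hm (Or.inl ⟨hm2, hv⟩)
  · intro v hv
    obtain ⟨m, ⟨φ, hφ, hm⟩, -⟩ := existsUnique_isFibreSize hends hvert harc
    obtain ⟨h, hdir⟩ := hφ.isHeight
    exact h.highlyArcTransitive hdir hends.1 hvert hqp hm (Or.inr hv)

end Digraph

theorem theorem11 {V : Type*} (Γ : Digraph V)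
    (hends : Γ.TwoEnded) (hvert : Γ.VertexTransitive) (harc : Γ.ArcTransitive) :
    -- the fibre size is well defined
    (∃! m : ℕ, Γ.IsFibreSize m) ∧
    -- locally quasi-primitive digraphs
    (Γ.LocallyQuasiPrimitive →
      (∀ m : ℕ, Γ.IsFibreSize m → 2 < m → ∀ v : V,
        ((m - 1).factorial : ℕ∞) < ENat.card (Γ.vertexStabilizer v) → Γ.HighlyArcTransitive) ∧
      (∀ v : V, Infinite (Γ.vertexStabilizer v) → Γ.HighlyArcTransitive)) ∧
    -- digraphs of prime out-valency
    (∀ p : ℕ, p.Prime → Γ.HasOutValency p →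
      (∀ m : ℕ, Γ.IsFibreSize m → 2 < m → ∀ v : V,
        ((m - 1).factorial : ℕ∞) < ENat.card (Γ.vertexStabilizer v) → Γ.HighlyArcTransitive) ∧
      (∀ v : V, Infinite (Γ.vertexStabilizer v) → Γ.HighlyArcTransitive)) := by
  refine ⟨Digraph.existsUnique_isFibreSize hends hvert harc, fun hqp => ?_, fun p hp hval => ?_⟩
  · exact Digraph.highlyArcTransitive_of_isQuasiPreprimitive hends hvert harc fun v => (hqp.2 v).2
  · exact Digraph.highlyArcTransitive_of_isQuasiPreprimitive hends hvert harc
      (Digraph.isQuasiPreprimitive_of_prime harc hp hval)
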